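/- Let $N\ge 2$, $E=\{0,\ldots,N-1\}$, $d,p,q\ge 0$, let $B_1,\ldots,B_q$, $A_1,\ldots,A_p$ be real $(N-1)\times(N-1)$ matrices and $\Gamma$ a real $(N-1)\times d$ matrix. For $y\in E$ let $\overline{y}\in\mathbb{R}^{N-1}$ be the $k$-th column of the identity matrix $I_{N-1}$ if $y=k\ge 1$, and $\overline{y}=0$ if $y=0$. Let $X=(X_t)_{t\in\mathbb{Z}}$ be a stationary and ergodic process with values in $\mathbb{R}^d$, defined on a probability space $(\Omega,\mathcal{A},\mathbb{P})$, such that $\mathbb{E}\log_+|X_1|<\infty$. A solution of the multinomial logistic autoregression driven by $X$ is a pair of processes $(Y_t)_{t\in\mathbb{Z}}$, $(\lambda_t)_{t\in\mathbb{Z}}$ with values in $E$ and $\mathbb{R}^{N-1}$ such that, almost surely for every $t\in\mathbb{Z}$, $$\mathbb{P}\left(Y_t=i\mid Y_{t-1},Y_{t-2},\ldots,X_t,X_{t-1},\ldots\right)=\frac{\exp(\lambda_{i,t})}{1+\sum_{j=1}^{N-1}\exp(\lambda_{j,t})},\qquad i=1,\ldots,N-1,$$ $$\lambda_t=\sum_{j=1}^q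 B_j\lambda_{t-j}+\sum_{\ell=1}^p A_\ell\overline{Y}_{t-\ell}+\Gamma X_t,$$ and the covariates are strictly exogenous: $$\mathbb{P}\left(Y_t=y\mid Y_{t-1},Y_{t-2},\ldots,X_t,X_{t-1},\ldots\right)=\mathbb{P}\left(Y_t=y\mid Y_{t-1},Y_{t-2},\ldots,(X_s)_{s\in\mathbb{Z}}\right),\qquad y\in E.$$ The solution is called stationary if the process $((Y_t,X_t))_{t\in\mathbb{Z}}$ is strictly stationary. Assume that all the complex roots $z$ of the polynomial $\mathcal{P}(z)=\det\left(I_{N-1}-\sum_{j=1}^q B_jz^j\right)$ satisfy $|z|>1$. Then there exists a stationary solution, defined on the enlargement $\Omega\times E^{\mathbb{Z}}$ of $\Omega$ endowed with a probability measure with first marginal $\mathbb{P}$, where $X$ is extended by $X_t(\omega,y)=X_t(\omega)$ and $Y_t(\omega,y)=y_t$. For this solution the process $((Y_t,X_t,\lambda_t))_{t\in\mathbb{Z}}$ is stationary, and the process $((Y_t,X_t))_{t\in\mathbb{Z}}$ is stationary and ergodic. The stationary solution is unique in the following sense: for every stationary solution, on any probability space, driven by a covariate process that has the same law as $X$, the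 process $((Y_t,X_t,\lambda_t))_{t\in\mathbb{Z}}$ has the same law as the one just constructed. -/

import Mathlib

open MeasureTheory ProbabilityTheory

noncomputable section

namespace MultinomialLogit

/-- The trajectory `(Z_t)_{t ∈ ℤ}` of a process indexed by `ℤ`, as a random sequence. -/
def path {Ω S : Type*} (Z : ℤ → Ω → S) : Ω → ℤ → S := fun ω t => Z t ω

/-- The shift `(z_t)_t ↦ (z_{t+1})_t` on two-sided sequences. -/
def shift {S : Type*} : (ℤ → S) → (ℤ → S) := fun z t => z (t + 1)

/-- Strict stationarity: the law of the trajectory is invariant under the shift. -/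
def IsStationary {Ω S : Type*} [MeasurableSpace Ω] [MeasurableSpace S]
    (P : Measure Ω) (Z : ℤ → Ω → S) : Prop :=
  MeasurePreserving shift (P.map (path Z)) (P.map (path Z))

/-- Stationarity and ergodicity: the law of the trajectory is invariant under the shift, and every
shift-invariant event has probability zero or one. -/
def IsStationaryErgodic {Ω S : Type*} [MeasurableSpace Ω] [MeasurableSpace S]
    (P : Measure Ω) (Z : ℤ → Ω → S) : Prop :=
  Ergodic shift (P.map (path Z))

/-- The σ-algebra generated by the variables `Z s` with `s ∈ I`. -/
abbrev sigmaGen {Ω S : Type*} [MeasurableSpace S] (Z : ℤ → Ω → S) (I : Set ℤ) : MeasurableSpace Ω :=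
  ⨆ s ∈ I, MeasurableSpace.comap (Z s) inferInstance

/-- The coding of the category `y ∈ {0, …, n}`: the `k`-th column of the identity matrix of size
`n` if `y = k ∈ {1, …, n}`, and the zero vector if `y` is the reference category `0`. (The index
`k : Fin n` stands for the category `k + 1`.) -/
def dummy {n : ℕ} (y : Fin (n + 1)) : Fin n → ℝ := fun k => if y = k.succ then 1 else 0

/-- The probability `exp (l_i) / (1 + ∑_j exp (l_j))` of the non-reference category `i`. -/
def logit {n : ℕ} (l : Fin n → ℝ) (i : Fin n) : ℝ :=
  Real.exp (l i) / (1 + ∑ j, Real.exp (l j))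

/-- `z ↦ det (I - ∑_{j=1}^q B_j z^j)` on the complex plane; `B j` is the matrix of lag `j + 1`. -/
def charFun {n q : ℕ} (B : Fin q → Matrix (Fin n) (Fin n) ℝ) (z : ℂ) : ℂ :=
  (1 - ∑ j : Fin q, z ^ ((j : ℕ) + 1) • (B j).map (algebraMap ℝ ℂ)).det

/-- `(Y, lam)` solves the multinomial logistic autoregression driven by the covariate process `X`
on the probability space `(Ω, P)`. The category set is `{0, …, n}`; `B j`, `A l` are the matrices
of lags `j + 1`, `l + 1`. -/
structure IsSolution {n d p q : ℕ} (B : Fin q → Matrix (Fin n) (Fin n) ℝ)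
    (A : Fin p → Matrix (Fin n) (Fin n) ℝ) (Γ : Matrix (Fin n) (Fin d) ℝ)
    {Ω : Type*} [MeasurableSpace Ω] (P : Measure Ω)
    (X : ℤ → Ω → Fin d → ℝ) (Y : ℤ → Ω → Fin (n + 1)) (lam : ℤ → Ω → Fin n → ℝ) : Prop where
  measurable_X : ∀ t, Measurable (X t)
  measurable_Y : ∀ t, Measurable (Y t)
  measurable_lam : ∀ t, Measurable (lam t)
  /-- The recursion for the latent process. -/
  recursion : ∀ t, ∀ᵐ ω ∂P, lam t ω =
    ∑ j : Fin q, (B j).mulVec (lam (t - ((j : ℤ) + 1)) ω)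
      + ∑ l : Fin p, (A l).mulVec (dummy (Y (t - ((l : ℤ) + 1)) ω))
      + Γ.mulVec (X t ω)
  /-- The conditional probabilities given `Y_{t-1}, Y_{t-2}, …` and `X_t, X_{t-1}, …`. -/
  condProb : ∀ (t : ℤ) (i : Fin n),
    P⟦Y t ⁻¹' {i.succ} | sigmaGen Y (Set.Iio t) ⊔ sigmaGen X (Set.Iic t)⟧
      =ᵐ[P] fun ω => logit (lam t ω) i
  /-- Strict exogeneity of the covariates: given `Y_{t-1}, Y_{t-2}, …` and `X_t, X_{t-1}, …`, the
  future of `X` brings no information on `Y_t`. -/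
  exogenous : ∀ (t : ℤ) (y : Fin (n + 1)),
    P⟦Y t ⁻¹' {y} | sigmaGen Y (Set.Iio t) ⊔ sigmaGen X (Set.Iic t)⟧
      =ᵐ[P] P⟦Y t ⁻¹' {y} | sigmaGen Y (Set.Iio t) ⊔ sigmaGen X Set.univ⟧

end MultinomialLogit

end

/-!
Given the environment `X`, the categories form a chain with complete connections: the probabilities
of `Y t` depend on the whole past, but the distortion caused by a change of the past before `t - k`
is geometrically small in `k`, because the roots of `charFun B` lie outside the unit disc and the
latent variable therefore forgets the past at a geometric rate.

*Uniqueness.* By the summability of the distortions, two laws which are compatible with the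
transition probabilities and have the same environment are bounded by multiples of each other.
Subtracting the best multiple leaves a compatible law, to which the comparison applies again; hence
the two laws are equal.

*Existence.* Drawing the categories at the times `-m`, …, `m - 1` one after the other gives laws
which are compatible at these times. A limit along an ultrafilter, on the events of bounded windows,
is σ-additive by the compactness of the space of sequences of categories, and it is compatible.

*Ergodicity.* The restriction of a compatible law to an invariant event is compatible, and its
environment is an invariant multiple of the law of `X`, hence proportional to it. By uniqueness the
event has probability zero or one.

*The latent process.* The conditional probabilities determine `lam`, which is therefore stationary
together with `(Y, X)`. The difference between `lam` and the function of the past which solves the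
recursion is a stationary solution of the homogeneous recursion, whose solutions tend to zero, so
that it vanishes by recurrence.
-/

noncomputable section

namespace MultinomialLogit

open Set Filter Topology
open scoped ENNReal NNReal

section Window

variable {𝓧 E : Type*} [MeasurableSpace 𝓧] [MeasurableSpace E] {I J : Set ℤ}

lemma measurable_of_coordinates {α : Type*} {_ : MeasurableSpace α} {f : α → 𝓧 × (ℤ → E)}
    (h : Measurable fun a => (f a).1) (h' : ∀ s, Measurable fun a => (f a).2 s) : Measurable f :=
  h.prodMk (measurable_pi_iff.2 h')

/-- The σ-algebra of the events of `𝓧 × (ℤ → E)` which are determined by the environment, the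
`𝓧`-component, and by the categories `y s` with `s ∈ I`. -/
abbrev window (I : Set ℤ) : MeasurableSpace (𝓧 × (ℤ → E)) :=
  MeasurableSpace.comap (fun z => (z.1, fun s : I => z.2 s)) inferInstance

lemma measurable_fst_window (I : Set ℤ) :
    Measurable[window I] (Prod.fst : 𝓧 × (ℤ → E) → 𝓧) :=
  (comap_measurable fun z : 𝓧 × (ℤ → E) => (z.1, fun s : I => z.2 s)).fst

lemma measurable_eval_window {s : ℤ} (hs : s ∈ I) :
    Measurable[window I] fun z : 𝓧 × (ℤ → E) => z.2 s :=
  (measurable_pi_apply (⟨s, hs⟩ : I)).comp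
    (comap_measurable fun z : 𝓧 × (ℤ → E) => (z.1, fun s : I => z.2 s)).snd

lemma measurable_window {α : Type*} {m : MeasurableSpace α} {f : α → 𝓧 × (ℤ → E)}
    (h : Measurable fun a => (f a).1) (h' : ∀ s ∈ I, Measurable fun a => (f a).2 s) :
    Measurable[m, window I] f := by
  rw [measurable_iff_comap_le, MeasurableSpace.comap_comp, ← measurable_iff_comap_le]
  exact h.prodMk (measurable_pi_iff.2 fun s => h' s s.2)

lemma window_le_of_measurable {m : MeasurableSpace (𝓧 × (ℤ → E))}
    (h : Measurable[m] (Prod.fst : 𝓧 × (ℤ → E) → 𝓧))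
    (h' : ∀ s ∈ I, Measurable[m] fun z : 𝓧 × (ℤ → E) => z.2 s) : window I ≤ m := by
  rw [← measurable_iff_comap_le]
  exact h.prodMk (measurable_pi_iff.2 fun s => h' s s.2)

lemma window_le (I : Set ℤ) :
    window (𝓧 := 𝓧) (E := E) I ≤ Prod.instMeasurableSpace :=
  window_le_of_measurable measurable_fst fun s _ => (measurable_pi_apply s).comp measurable_snd

lemma window_mono (h : I ⊆ J) : window (𝓧 := 𝓧) (E := E) I ≤ window J :=
  window_le_of_measurable (measurable_fst_window J) fun _ hs => measurable_eval_window (h hs)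

lemma window_univ : window (𝓧 := 𝓧) (E := E) univ = Prod.instMeasurableSpace := by
  refine (window_le univ).antisymm ?_
  have hid : Measurable[window univ] (id : 𝓧 × (ℤ → E) → 𝓧 × (ℤ → E)) :=
    measurable_of_coordinates (measurable_fst_window univ)
      fun s => measurable_eval_window (mem_univ s)
  exact fun A hA => hid hA

lemma window_iUnion {ι : Type*} [Nonempty ι] (I : ι → Set ℤ) :
    window (𝓧 := 𝓧) (E := E) (⋃ i, I i) = ⨆ i, window (I i) := by
  refine le_antisymm (window_le_of_measurable ?_ fun s hs => ?_)
    (iSup_le fun i => window_mono (subset_iUnion I i))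
  · obtain ⟨i⟩ := ‹Nonempty ι›
    exact (measurable_fst_window (I i)).mono (le_iSup (fun i => window (I i)) i) le_rfl
  · obtain ⟨i, hi⟩ := mem_iUnion.1 hs
    exact (measurable_eval_window hi).mono (le_iSup (fun i => window (I i)) i) le_rfl

lemma measurable_window_piecewise [DecidablePred (· ∈ I)] (v : ℤ → E) :
    Measurable[window I] fun z : 𝓧 × (ℤ → E) => (z.1, I.piecewise z.2 v) := by
  refine measurable_of_coordinates (measurable_fst_window I) fun s => ?_
  by_cases hs : s ∈ I
  · simpa only [hs, piecewise_eq_of_mem] using measurable_eval_window hs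
  · simpa only [hs, not_false_eq_true, piecewise_eq_of_notMem] using measurable_const

lemma mem_iff_of_measurableSet_window {A : Set (𝓧 × (ℤ → E))} (hA : MeasurableSet[window I] A)
    {x : 𝓧} {v w : ℤ → E} (h : EqOn v w I) : (x, v) ∈ A ↔ (x, w) ∈ A := by
  obtain ⟨B, -, rfl⟩ := hA
  have : (fun s : I => v s) = fun s : I => w s := funext fun s => h s.2
  simp only [mem_preimage, this]

/-- The cylinder of the sequences which read the word `v` on `I`. -/
def cyl (I : Set ℤ) (v : ℤ → E) : Set (𝓧 × (ℤ → E)) := {z | EqOn z.2 v I}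

lemma measurableSet_cyl [MeasurableSingletonClass E] (h : I ⊆ J) (v : ℤ → E) :
    MeasurableSet[window J] (cyl (𝓧 := 𝓧) I v) := by
  have hcyl : cyl (𝓧 := 𝓧) I v = ⋂ s ∈ I, (fun z : 𝓧 × (ℤ → E) => z.2 s) ⁻¹' {v s} := by
    ext z; simp [cyl, EqOn]
  rw [hcyl]
  exact MeasurableSet.biInter (to_countable I) fun s hs =>
    measurable_eval_window (h hs) (measurableSet_singleton _)

/-- On an event of a finite window, the sequence matters through finitely many words only, so that
the event is cut by cylinders into events of the environment. -/
lemma inter_cyl_eq {A : Set (𝓧 × (ℤ → E))} (hA : MeasurableSet[window I] A) (v : ℤ → E) :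
    A ∩ cyl I v = cyl I v ∩ Prod.fst ⁻¹' {x | (x, v) ∈ A} := by
  ext ⟨x, w⟩
  rw [inter_comm]
  exact and_congr_right fun hw => mem_iff_of_measurableSet_window hA hw

end Window

section LocalEvents

variable {𝓧 E : Type*} [MeasurableSpace 𝓧] [MeasurableSpace E]

lemma measure_le_mul_of_forall_symmDiff_lt {α : Type*} {m : MeasurableSpace α}
    {ρ ν ν' : Measure α} (hν : ν ≤ ρ) (hν' : ν' ≤ ρ) {K : ℝ≥0∞} (hK : K ≠ ∞) {A : Set α}
    (h : ∀ ε, 0 < ε → ∃ B, ρ (symmDiff B A) < ε ∧ ν B ≤ K * ν' B) : ν A ≤ K * ν' A := by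
  have hlim : Tendsto (fun ε : ℝ≥0∞ => K * (ν' A + ε) + ε) (𝓝[>] 0) (𝓝 (K * (ν' A + 0) + 0)) :=
    ((ENNReal.Tendsto.const_mul (tendsto_const_nhds.add tendsto_id) (Or.inr hK)).add
      tendsto_id).mono_left nhdsWithin_le_nhds
  simp only [add_zero] at hlim
  refine ge_of_tendsto hlim ?_
  filter_upwards [self_mem_nhdsWithin] with ε hε
  obtain ⟨B, hBε, hB⟩ := h ε hε
  have h₁ : ν A ≤ ν B + ε := by
    have hA : A ⊆ B ∪ symmDiff B A := fun z hz => by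
      by_cases hzB : z ∈ B <;> simp [mem_symmDiff, hz, hzB]
    exact (measure_mono hA).trans ((measure_union_le _ _).trans
      (add_le_add_right ((hν _).trans hBε.le) _))
  have h₂ : ν' B ≤ ν' A + ε := by
    have hBA : B ⊆ A ∪ symmDiff B A := fun z hz => by
      by_cases hzA : z ∈ A <;> simp [mem_symmDiff, hz, hzA]
    exact (measure_mono hBA).trans ((measure_union_le _ _).trans
      (add_le_add_right ((hν' _).trans hBε.le) _))
  calc ν A ≤ ν B + ε := h₁
    _ ≤ K * ν' B + ε := by gcongr
    _ ≤ K * (ν' A + ε) + ε := by gcongr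

/-- The events which depend on the categories through one of the windows `J k` only; for bounded
`J k` these are the local events. -/
def localEvents (J : ℕ → Set ℤ) : Set (Set (𝓧 × (ℤ → E))) :=
  {A | ∃ k, MeasurableSet[window (J k)] A}

variable {J : ℕ → Set ℤ}

lemma isSetRing_localEvents (hJ : Monotone J) : IsSetRing (localEvents (𝓧 := 𝓧) (E := E) J) where
  empty_mem := ⟨0, @MeasurableSet.empty _ (window (J 0))⟩
  union_mem := fun A B ⟨k, hA⟩ ⟨l, hB⟩ => ⟨max k l,
    (window_mono (hJ (le_max_left k l)) A hA).union (window_mono (hJ (le_max_right k l)) B hB)⟩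
  sdiff_mem := fun A B ⟨k, hA⟩ ⟨l, hB⟩ => ⟨max k l,
    (window_mono (hJ (le_max_left k l)) A hA).diff (window_mono (hJ (le_max_right k l)) B hB)⟩

lemma generateFrom_localEvents :
    MeasurableSpace.generateFrom (localEvents (𝓧 := 𝓧) (E := E) J) = window (⋃ k, J k) := by
  rw [window_iUnion, MeasurableSpace.measurableSpace_iSup_eq]
  rfl

lemma measure_eq_of_localEvents (hJ : Monotone J) {ν ν' : Measure (𝓧 × (ℤ → E))}
    [IsFiniteMeasure ν] (h : ∀ A ∈ localEvents J, ν A = ν' A) {A : Set (𝓧 × (ℤ → E))}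
    (hA : MeasurableSet[window (⋃ k, J k)] A) : ν A = ν' A :=
  ext_on_measurableSpace_of_generate_finite _ _ h (window_le _) generateFrom_localEvents.symm
    (fun _ hB _ hC _ => (isSetRing_localEvents hJ).inter_mem hB hC)
    (h _ ⟨0, @MeasurableSet.univ _ (window (J 0))⟩) hA

lemma exists_mem_localEvents_symmDiff_lt (hJ : Monotone J) (hU : ⋃ k, J k = univ)
    (ν : Measure (𝓧 × (ℤ → E))) [IsFiniteMeasure ν] {A : Set (𝓧 × (ℤ → E))}
    (hA : MeasurableSet A) {ε : ℝ≥0∞} (hε : 0 < ε) :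
    ∃ B ∈ localEvents J, ν (symmDiff B A) < ε :=
  exists_measure_symmDiff_lt_of_generateFrom_isSetRing (isSetRing_localEvents hJ)
    ⟨{univ}, countable_singleton _, by simp [localEvents], by simp⟩
    (by rw [generateFrom_localEvents, hU, window_univ]) hA hε

lemma measure_le_smul_of_localEvents (hJ : Monotone J) (hU : ⋃ k, J k = univ)
    {ν ν' : Measure (𝓧 × (ℤ → E))} [IsFiniteMeasure ν] [IsFiniteMeasure ν'] {K : ℝ≥0∞}
    (hK : K ≠ ∞) (h : ∀ A ∈ localEvents J, ν A ≤ K * ν' A) : ν ≤ K • ν' := by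
  refine Measure.le_iff.2 fun A hA => ?_
  refine measure_le_mul_of_forall_symmDiff_lt (Measure.le_add_right le_rfl)
    (Measure.le_add_left le_rfl) hK fun ε hε => ?_
  obtain ⟨B, hB, hBε⟩ := exists_mem_localEvents_symmDiff_lt hJ hU (ν + ν') hA hε
  exact ⟨B, hBε, h B hB⟩

lemma measure_le_mul_of_cyl [Finite E] [Nonempty E] [MeasurableSingletonClass E]
    {ν ν' : Measure (𝓧 × (ℤ → E))} {K : ℝ≥0∞} {I : Set ℤ} (hI : I.Finite)
    (h : ∀ (v : ℤ → E) (C : Set 𝓧), MeasurableSet C →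
      ν (cyl I v ∩ Prod.fst ⁻¹' C) ≤ K * ν' (cyl I v ∩ Prod.fst ⁻¹' C))
    {A : Set (𝓧 × (ℤ → E))} (hA : MeasurableSet[window I] A) : ν A ≤ K * ν' A := by
  have := hI.to_subtype
  have := Fintype.ofFinite (I → E)
  have hword : Measurable fun z : 𝓧 × (ℤ → E) => fun s : I => z.2 s := by fun_prop
  have hsum : ∀ μ : Measure (𝓧 × (ℤ → E)),
      μ A = ∑ w : I → E, μ ((fun z => fun s : I => z.2 s) ⁻¹' {w} ∩ A) := fun μ => by
    rw [← Measure.restrict_apply_univ A, ← preimage_univ (f := fun z => fun s : I => z.2 s),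
      ← Finset.coe_univ, ← sum_measure_preimage_singleton _ fun w _ => hword (.singleton w)]
    exact Finset.sum_congr rfl fun w _ => Measure.restrict_apply (hword (.singleton w))
  rw [hsum ν, hsum ν', Finset.mul_sum]
  refine Finset.sum_le_sum fun w _ => ?_
  obtain ⟨v, rfl⟩ : ∃ v : ℤ → E, (fun s : I => v s) = w :=
    ⟨Function.extend Subtype.val w fun _ => Classical.arbitrary E,
      funext fun s => Subtype.val_injective.extend_apply w _ s⟩
  have hcyl : (fun z : 𝓧 × (ℤ → E) => fun s : I => z.2 s) ⁻¹' {fun s : I => v s} = cyl I v := by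
    ext z
    simp [cyl, EqOn, funext_iff]
  rw [hcyl, inter_comm, inter_cyl_eq hA]
  exact h v _ (measurable_prodMk_right (window_le I A hA))

end LocalEvents

section Compatible

lemma cyl_Ico_succ {𝓧 E : Type*} (s : ℤ) (m : ℕ) (v : ℤ → E) :
    cyl (𝓧 := 𝓧) (Ico s (s + (m + 1 : ℕ))) v =
      cyl (Ico s (s + m)) v ∩ {z | z.2 (s + m) = v (s + m)} := by
  have : Ico s (s + (m + 1 : ℕ)) = Ico s (s + m) ∪ {s + m} := by
    ext i
    simp only [mem_Ico, union_singleton, mem_insert_iff]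
    omega
  ext z
  simp only [cyl, this, mem_ofPred_eq, mem_inter_iff, eqOn_union, eqOn_singleton]

variable {𝓧 E : Type*} [MeasurableSpace 𝓧] [MeasurableSpace E]

/-- The transition probabilities `g t y z` of a chain with complete connections in an environment:
the probability of the category `y` at time `t`, given the environment `z.1` and the past of `z.2`
before `t`. A change of the categories before `t - k` affects them by a factor at most
`exp (r k)`. -/
structure IsTransition [Fintype E] (g : ℤ → E → 𝓧 × (ℤ → E) → ℝ≥0∞) (r : ℕ → ℝ) : Prop where
  measurable : ∀ t y, Measurable[window (Iio t)] (g t y)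
  sum_eq_one : ∀ t z, ∑ y, g t y z = 1
  nonneg : ∀ k, 0 ≤ r k
  summable : Summable r
  distortion : ∀ (t : ℤ) (y : E) (k : ℕ) (x : 𝓧) (v w : ℤ → E), EqOn v w (Ico (t - k) t) →
    g t y (x, v) ≤ ENNReal.ofReal (Real.exp (r k)) * g t y (x, w)

/-- Under `Q`, the conditional law of the category at time `t`, given the environment and the
categories before `t`, is `g t`. -/
def IsCompatibleAt (g : ℤ → E → 𝓧 × (ℤ → E) → ℝ≥0∞) (Q : Measure (𝓧 × (ℤ → E))) (t : ℤ) : Prop :=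
  ∀ y, ∀ A, MeasurableSet[window (Iio t)] A → Q (A ∩ {z | z.2 t = y}) = ∫⁻ z in A, g t y z ∂Q

/-- The law `Q` of an environment and a sequence of categories is compatible with the transition
probabilities `g`. -/
def IsCompatible (g : ℤ → E → 𝓧 × (ℤ → E) → ℝ≥0∞) (Q : Measure (𝓧 × (ℤ → E))) : Prop :=
  ∀ t, IsCompatibleAt g Q t

variable {g : ℤ → E → 𝓧 × (ℤ → E) → ℝ≥0∞} {Q Q' : Measure (𝓧 × (ℤ → E))} {t : ℤ}

lemma IsCompatible.smul (hQ : IsCompatible g Q) (c : ℝ≥0∞) : IsCompatible g (c • Q) :=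
  fun t y A hA => by
    rw [Measure.smul_apply, hQ t y A hA, Measure.restrict_smul, lintegral_smul_measure]

lemma IsCompatible.of_add [IsFiniteMeasure Q'] (hadd : IsCompatible g (Q + Q'))
    (hQ' : IsCompatible g Q') : IsCompatible g Q := by
  intro t y A hA
  have hfin : ∫⁻ z in A, g t y z ∂Q' ≠ ∞ := by
    rw [← hQ' t y A hA]
    exact measure_ne_top _ _
  have h := hadd t y A hA
  rw [Measure.add_apply, Measure.restrict_add, lintegral_add_measure, hQ' t y A hA] at h
  exact (ENNReal.add_left_inj hfin).1 h

lemma setLIntegral_congr_of_window {I : Set ℤ}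
    (h : ∀ C, MeasurableSet[window I] C → Q C = Q' C) {A : Set (𝓧 × (ℤ → E))}
    (hA : MeasurableSet[window I] A) {f : 𝓧 × (ℤ → E) → ℝ≥0∞} (hf : Measurable[window I] f) :
    ∫⁻ z in A, f z ∂Q = ∫⁻ z in A, f z ∂Q' := by
  have hle := window_le (𝓧 := 𝓧) (E := E) I
  have htrim : Q.trim hle = Q'.trim hle := @Measure.ext _ (window I) _ _ fun C hC => by
    rw [trim_measurableSet_eq hle hC, trim_measurableSet_eq hle hC, h C hC]
  rw [← lintegral_indicator (hle A hA), ← lintegral_trim hle (hf.indicator hA), htrim,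
    lintegral_trim hle (hf.indicator hA), lintegral_indicator (hle A hA)]

lemma IsCompatibleAt.restrict_category_apply (hQ : IsCompatibleAt g Q t) (y : E)
    {A C : Set (𝓧 × (ℤ → E))} (hA : MeasurableSet[window (Iio t)] A)
    (hC : MeasurableSet[window (Iio t)] C) :
    Q.restrict (A ∩ {z | z.2 t = y}) C = (Q.restrict A).withDensity (g t y) C := by
  have hC' := window_le _ _ hC
  rw [withDensity_apply _ hC', Measure.restrict_restrict hC', Measure.restrict_apply hC',
    ← inter_assoc]
  exact hQ y _ (MeasurableSet.inter (m := window (Iio t)) hC hA)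

lemma measurableSet_category [MeasurableSingletonClass E] (t : ℤ) (y : E) :
    MeasurableSet {z : 𝓧 × (ℤ → E) | z.2 t = y} :=
  (by fun_prop : Measurable fun z : 𝓧 × (ℤ → E) => z.2 t) (measurableSet_singleton y)

variable [Fintype E] {r : ℕ → ℝ}

lemma IsTransition.measurable_prod (hg : IsTransition g r) (t : ℤ) (y : E) : Measurable (g t y) :=
  (hg.measurable t y).mono (window_le _) le_rfl

lemma IsTransition.le_one (hg : IsTransition g r) (t : ℤ) (y : E) (z : 𝓧 × (ℤ → E)) :
    g t y z ≤ 1 :=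
  (Finset.single_le_sum (fun _ _ => zero_le) (Finset.mem_univ y)).trans_eq (hg.sum_eq_one t z)

lemma IsTransition.sum_setLIntegral (hg : IsTransition g r) (t : ℤ) (A : Set (𝓧 × (ℤ → E))) :
    ∑ y, ∫⁻ z in A, g t y z ∂Q = Q A := by
  rw [← lintegral_finsetSum _ fun y _ => hg.measurable_prod t y]
  simp only [hg.sum_eq_one, lintegral_one, Measure.restrict_apply_univ]

lemma IsCompatibleAt.setLIntegral_category (hg : IsTransition g r) (hQ : IsCompatibleAt g Q t)
    (y : E) {A : Set (𝓧 × (ℤ → E))} (hA : MeasurableSet[window (Iio t)] A)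
    {f : 𝓧 × (ℤ → E) → ℝ≥0∞} (hf : Measurable[window (Iio t)] f) :
    ∫⁻ z in A ∩ {z | z.2 t = y}, f z ∂Q = ∫⁻ z in A, f z * g t y z ∂Q := by
  rw [← setLIntegral_univ, setLIntegral_congr_of_window
    (fun _ hC => hQ.restrict_category_apply y hA hC) .univ hf, setLIntegral_univ,
    lintegral_withDensity_eq_lintegral_mul _ (hg.measurable_prod t y)
      (hf.mono (window_le _) le_rfl)]
  simp only [Pi.mul_apply, mul_comm]

lemma IsCompatible.setLIntegral_cyl_succ [MeasurableSingletonClass E] (hg : IsTransition g r)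
    (hQ : IsCompatible g Q) (v : ℤ → E) (s : ℤ) (m : ℕ) {F : 𝓧 → ℝ≥0∞} (hF : Measurable F) :
    ∫⁻ z in cyl (Ico s (s + (m + 1 : ℕ))) v, F z.1 ∂Q =
      ∫⁻ z in cyl (Ico s (s + m)) v, F z.1 * g (s + m) (v (s + m)) z ∂Q := by
  have hFt : Measurable[window (Iio (s + m))] fun z : 𝓧 × (ℤ → E) => F z.1 :=
    hF.comp (measurable_fst_window _)
  rw [cyl_Ico_succ, (hQ _).setLIntegral_category hg _ (measurableSet_cyl Ico_subset_Iio_self v) hFt]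

lemma IsTransition.setLIntegral_le_word [MeasurableSingletonClass E] (hg : IsTransition g r)
    (Q : Measure (𝓧 × (ℤ → E))) (v : ℤ → E) (t : ℤ) (y : E) (m : ℕ) (F : 𝓧 → ℝ≥0∞) :
    ∫⁻ z in cyl (Ico (t - m) t) v, F z.1 * g t y z ∂Q ≤
      ENNReal.ofReal (Real.exp (r m)) *
        ∫⁻ z in cyl (Ico (t - m) t) v, F z.1 * g t y (z.1, v) ∂Q := by
  rw [← lintegral_const_mul' _ _ ENNReal.ofReal_ne_top]
  refine setLIntegral_mono' (window_le _ _ (measurableSet_cyl subset_rfl v)) fun z hz => ?_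
  rw [mul_left_comm]
  exact mul_le_mul_right (hg.distortion t _ m z.1 z.2 v hz) _

lemma IsTransition.setLIntegral_word_le [MeasurableSingletonClass E] (hg : IsTransition g r)
    (Q : Measure (𝓧 × (ℤ → E))) (v : ℤ → E) (t : ℤ) (y : E) (m : ℕ) (F : 𝓧 → ℝ≥0∞) :
    ∫⁻ z in cyl (Ico (t - m) t) v, F z.1 * g t y (z.1, v) ∂Q ≤
      ENNReal.ofReal (Real.exp (r m)) *
        ∫⁻ z in cyl (Ico (t - m) t) v, F z.1 * g t y z ∂Q := by
  rw [← lintegral_const_mul' _ _ ENNReal.ofReal_ne_top]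
  refine setLIntegral_mono' (window_le _ _ (measurableSet_cyl subset_rfl v)) fun z hz => ?_
  rw [mul_left_comm]
  exact mul_le_mul_right (hg.distortion t _ m z.1 v z.2 (EqOn.symm hz)) _

/-- On a cylinder, the past in the transition probability may be replaced by the word, up to the
distortion; what remains is a function of the environment. -/
lemma IsCompatible.setLIntegral_cyl_le [MeasurableSingletonClass E] (hg : IsTransition g r)
    (hQ : IsCompatible g Q) (hQ' : IsCompatible g Q') (hfst : Q.map Prod.fst = Q'.map Prod.fst)
    (v : ℤ → E) (s : ℤ) (m : ℕ) {F : 𝓧 → ℝ≥0∞} (hF : Measurable F) :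
    ∫⁻ z in cyl (Ico s (s + m)) v, F z.1 ∂Q ≤
      ENNReal.ofReal (Real.exp (2 * ∑ i ∈ Finset.range m, r i)) *
        ∫⁻ z in cyl (Ico s (s + m)) v, F z.1 ∂Q' := by
  induction m generalizing F with
  | zero =>
    have hcyl : cyl (𝓧 := 𝓧) (Ico s (s + (0 : ℕ))) v = univ := by simp [cyl]
    rw [hcyl, setLIntegral_univ, setLIntegral_univ, ← lintegral_map hF measurable_fst, hfst,
      lintegral_map hF measurable_fst]
    simp
  | succ m ih =>
    rw [hQ.setLIntegral_cyl_succ hg v s m hF, hQ'.setLIntegral_cyl_succ hg v s m hF]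
    obtain ⟨t, rfl⟩ : ∃ t : ℤ, s = t - m := ⟨s + m, (add_sub_cancel_right _ _).symm⟩
    simp only [sub_add_cancel] at ih ⊢
    set e := ENNReal.ofReal (Real.exp (r m)) with he
    set c := ENNReal.ofReal (Real.exp (2 * ∑ i ∈ Finset.range m, r i)) with hc
    have hG : Measurable fun x => F x * g t (v t) (x, v) :=
      hF.mul ((hg.measurable_prod t (v t)).comp measurable_prodMk_right)
    calc ∫⁻ z in cyl (Ico (t - m) t) v, F z.1 * g t (v t) z ∂Q
        ≤ e * ∫⁻ z in cyl (Ico (t - m) t) v, F z.1 * g t (v t) (z.1, v) ∂Q :=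
          hg.setLIntegral_le_word Q v t _ m F
      _ ≤ e * (c * ∫⁻ z in cyl (Ico (t - m) t) v, F z.1 * g t (v t) (z.1, v) ∂Q') := by
          gcongr
          exact ih hG
      _ ≤ e * (c * (e * ∫⁻ z in cyl (Ico (t - m) t) v, F z.1 * g t (v t) z ∂Q')) := by
          gcongr
          exact hg.setLIntegral_word_le Q' v t _ m F
      _ = ENNReal.ofReal (Real.exp (2 * ∑ i ∈ Finset.range (m + 1), r i)) *
            ∫⁻ z in cyl (Ico (t - m) t) v, F z.1 * g t (v t) z ∂Q' := by
          rw [Finset.sum_range_succ, mul_add, two_mul (r m), Real.exp_add, Real.exp_add,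
            ENNReal.ofReal_mul (Real.exp_nonneg _), ENNReal.ofReal_mul (Real.exp_nonneg _), ← he,
            ← hc]
          ring

lemma monotone_Ico_neg : Monotone fun m : ℕ => Ico (-m : ℤ) m := fun _ _ h =>
  Ico_subset_Ico (by simpa using h) (by simpa using h)

lemma iUnion_Ico_neg : ⋃ m : ℕ, Ico (-m : ℤ) m = univ :=
  eq_univ_of_forall fun s => mem_iUnion.2 ⟨s.natAbs + 1, by simp only [mem_Ico]; omega⟩

lemma IsCompatible.le_smul [MeasurableSingletonClass E] [Nonempty E] [IsFiniteMeasure Q]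
    [IsFiniteMeasure Q'] (hg : IsTransition g r) (hQ : IsCompatible g Q)
    (hQ' : IsCompatible g Q') (hfst : Q.map Prod.fst = Q'.map Prod.fst) :
    Q ≤ ENNReal.ofReal (Real.exp (2 * ∑' i, r i)) • Q' := by
  refine measure_le_smul_of_localEvents monotone_Ico_neg iUnion_Ico_neg ENNReal.ofReal_ne_top ?_
  rintro A ⟨m, hA⟩
  refine measure_le_mul_of_cyl (finite_Ico _ _) (fun v C hC => ?_) hA
  have hcyl : ∀ ν : Measure (𝓧 × (ℤ → E)), ν (cyl (Ico (-m : ℤ) m) v ∩ Prod.fst ⁻¹' C) =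
      ∫⁻ z in cyl (Ico (-m : ℤ) m) v, C.indicator 1 z.1 ∂ν := fun ν => by
    have : (fun z : 𝓧 × (ℤ → E) => C.indicator (1 : 𝓧 → ℝ≥0∞) z.1) =
        (Prod.fst ⁻¹' C).indicator 1 := rfl
    rw [this, lintegral_indicator_one (measurable_fst hC), Measure.restrict_apply
      (measurable_fst hC), inter_comm]
  have hm : (m : ℤ) = -m + (2 * m : ℕ) := by omega
  rw [hcyl Q, hcyl Q']
  nth_rewrite 2 [hm]
  nth_rewrite 4 [hm]
  refine (hQ.setLIntegral_cyl_le hg hQ' hfst v _ _ (measurable_one.indicator hC)).trans ?_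
  gcongr
  exact hg.summable.sum_le_tsum _ fun i _ => hg.nonneg i

/-- The largest `c` with `c Q ≤ Q'` is at least `1`: otherwise the comparison of `(1 - c) Q` with
the compatible measure `Q' - c Q` improves `c`. -/
lemma IsCompatible.le_of_map_fst_eq [MeasurableSingletonClass E] [Nonempty E] [IsFiniteMeasure Q]
    [IsFiniteMeasure Q'] (hg : IsTransition g r) (hQ : IsCompatible g Q)
    (hQ' : IsCompatible g Q') (hfst : Q.map Prod.fst = Q'.map Prod.fst) : Q ≤ Q' := by
  set K := ENNReal.ofReal (Real.exp (2 * ∑' i, r i)) with hK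
  set c := sSup {c : ℝ≥0∞ | c • Q ≤ Q'} with hc
  have hcQ : c • Q ≤ Q' := fun A => by
    rw [Measure.smul_apply, smul_eq_mul, hc, ENNReal.sSup_mul]
    exact iSup₂_le fun b hb => hb A
  suffices h1 : 1 ≤ c from fun A => by
    refine le_trans ?_ (hcQ A)
    rw [Measure.smul_apply, smul_eq_mul]
    exact le_mul_of_one_le_left' h1
  by_contra! hlt
  have : IsFiniteMeasure (c • Q) := Q.smul_finite hlt.ne_top
  have : IsFiniteMeasure ((1 - c) • Q) := Q.smul_finite (by finiteness)
  set R := Q' - c • Q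
  have hadd : R + c • Q = Q' := Measure.sub_add_cancel_of_le hcQ
  have hR : IsCompatible g R := .of_add (hadd.symm ▸ hQ') (hQ.smul c)
  have hsplit : (1 - c) • Q + c • Q = Q := by
    rw [← add_smul, tsub_add_cancel_of_le hlt.le, one_smul]
  have hRfst : ((1 - c) • Q).map Prod.fst = R.map Prod.fst := by
    have h : ((1 - c) • Q).map Prod.fst + (c • Q).map Prod.fst =
        R.map Prod.fst + (c • Q).map Prod.fst := by
      rw [← Measure.map_add _ _ measurable_fst, ← Measure.map_add _ _ measurable_fst, hsplit,
        hadd, hfst]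
    ext C -
    have hC := congr($h C)
    rw [Measure.add_apply, Measure.add_apply] at hC
    exact (ENNReal.add_left_inj (measure_ne_top _ _)).1 hC
  have hgain : (K⁻¹ * (1 - c)) • Q ≤ R := fun A => by
    have h := (hQ.smul (1 - c)).le_smul hg hR hRfst A
    rw [Measure.smul_apply, smul_eq_mul, mul_assoc, mul_comm, ← div_eq_mul_inv]
    exact ENNReal.div_le_of_le_mul' h
  have hle : K⁻¹ * (1 - c) + c ≤ c := by
    refine le_sSup (show (K⁻¹ * (1 - c) + c) • Q ≤ Q' from ?_)
    rw [add_smul, ← hadd]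
    exact add_le_add hgain le_rfl
  have hpos : K⁻¹ * (1 - c) ≠ 0 :=
    mul_ne_zero (by simp [hK]) (tsub_pos_of_lt hlt).ne'
  exact (ENNReal.lt_add_right hlt.ne_top hpos).not_ge (add_comm c _ ▸ hle)

theorem IsCompatible.eq_of_map_fst_eq [MeasurableSingletonClass E] [Nonempty E]
    [IsFiniteMeasure Q] [IsFiniteMeasure Q'] (hg : IsTransition g r) (hQ : IsCompatible g Q)
    (hQ' : IsCompatible g Q') (hfst : Q.map Prod.fst = Q'.map Prod.fst) : Q = Q' :=
  le_antisymm (hQ.le_of_map_fst_eq hg hQ' hfst) (hQ'.le_of_map_fst_eq hg hQ hfst.symm)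

end Compatible

section Resample

variable {𝓧 E : Type*} [MeasurableSpace 𝓧] [MeasurableSpace E]
  {g : ℤ → E → 𝓧 × (ℤ → E) → ℝ≥0∞}

/-- The category at time `t` of `z` is replaced by `y`. -/
def setCategory (t : ℤ) (y : E) (z : 𝓧 × (ℤ → E)) : 𝓧 × (ℤ → E) :=
  (z.1, Function.update z.2 t y)

lemma measurable_setCategory (t : ℤ) (y : E) : Measurable (setCategory (𝓧 := 𝓧) t y) := by
  refine measurable_of_coordinates measurable_fst fun s => ?_
  by_cases h : s = t
  · subst h; simp only [setCategory, Function.update_self]; fun_prop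
  · simp only [setCategory, Function.update_of_ne h]; fun_prop

lemma preimage_setCategory {I : Set ℤ} {t : ℤ} (ht : t ∉ I) (y : E) {A : Set (𝓧 × (ℤ → E))}
    (hA : MeasurableSet[window I] A) : setCategory t y ⁻¹' A = A := by
  ext ⟨x, v⟩
  exact mem_iff_of_measurableSet_window hA fun s hs =>
    Function.update_of_ne (ne_of_mem_of_not_mem hs ht) y v

variable [Fintype E]

/-- The category at time `t` is drawn again, with the probabilities `g t`. -/
def resample (g : ℤ → E → 𝓧 × (ℤ → E) → ℝ≥0∞) (t : ℤ) (Q : Measure (𝓧 × (ℤ → E))) :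
    Measure (𝓧 × (ℤ → E)) :=
  ∑ y, (Q.withDensity (g t y)).map (setCategory t y)

lemma resample_apply (t : ℤ) (Q : Measure (𝓧 × (ℤ → E))) {A : Set (𝓧 × (ℤ → E))}
    (hA : MeasurableSet A) :
    resample g t Q A = ∑ y, ∫⁻ z in setCategory t y ⁻¹' A, g t y z ∂Q := by
  rw [resample, Measure.finsetSum_apply]
  refine Finset.sum_congr rfl fun y _ => ?_
  rw [Measure.map_apply (measurable_setCategory t y) hA,
    withDensity_apply _ (measurable_setCategory t y hA)]

variable {r : ℕ → ℝ} {Q : Measure (𝓧 × (ℤ → E))} {t : ℤ}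

lemma resample_apply_window (hg : IsTransition g r) {A : Set (𝓧 × (ℤ → E))}
    (hA : MeasurableSet[window (Iio t)] A) : resample g t Q A = Q A := by
  rw [resample_apply _ _ (window_le _ _ hA)]
  simp only [preimage_setCategory self_notMem_Iio _ hA, hg.sum_setLIntegral]

lemma setLIntegral_resample (hg : IsTransition g r) {A : Set (𝓧 × (ℤ → E))}
    (hA : MeasurableSet[window (Iio t)] A) {f : 𝓧 × (ℤ → E) → ℝ≥0∞}
    (hf : Measurable[window (Iio t)] f) :
    ∫⁻ z in A, f z ∂(resample g t Q) = ∫⁻ z in A, f z ∂Q :=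
  setLIntegral_congr_of_window (fun _ hC => resample_apply_window hg hC) hA hf

lemma isCompatibleAt_resample [MeasurableSingletonClass E] (hg : IsTransition g r) :
    IsCompatibleAt g (resample g t Q) t := by
  classical
  intro y A hA
  have hpre : ∀ y', setCategory t y' ⁻¹' (A ∩ {z | z.2 t = y}) = if y' = y then A else ∅ := by
    intro y'
    rw [preimage_inter, preimage_setCategory self_notMem_Iio _ hA]
    ext z
    by_cases h : y' = y <;> simp [setCategory, h]
  rw [resample_apply _ _ ((window_le _ _ hA).inter (measurableSet_category t y)),
    setLIntegral_resample hg hA (hg.measurable t y), Finset.sum_eq_single y]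
  · rw [hpre, if_pos rfl]
  · intro y' _ hne
    rw [hpre, if_neg hne, setLIntegral_empty]
  · simp

lemma IsCompatibleAt.resample [MeasurableSingletonClass E] (hg : IsTransition g r) {s : ℤ}
    (hst : s < t) (hQ : IsCompatibleAt g Q s) : IsCompatibleAt g (resample g t Q) s := by
  intro y A hA
  have hmono := window_mono (𝓧 := 𝓧) (E := E) (Iio_subset_Iio hst.le)
  have hs : MeasurableSet[window (Iio t)] {z : 𝓧 × (ℤ → E) | z.2 s = y} :=
    measurable_eval_window (mem_Iio.2 hst) (measurableSet_singleton y)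
  rw [resample_apply_window hg (MeasurableSet.inter (hmono _ hA) hs), hQ y A hA,
    setLIntegral_resample hg (hmono _ hA) ((hg.measurable s y).mono hmono le_rfl)]

lemma map_fst_resample (hg : IsTransition g r) :
    (resample g t Q).map Prod.fst = Q.map Prod.fst := by
  refine Measure.ext fun C hC => ?_
  rw [Measure.map_apply measurable_fst hC, Measure.map_apply measurable_fst hC,
    resample_apply_window hg (measurable_fst_window _ hC)]

lemma exists_isCompatibleAt_Ico [MeasurableSingletonClass E] [Nonempty E]
    (hg : IsTransition g r) (μ : Measure 𝓧) (s : ℤ) (m : ℕ) :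
    ∃ Q : Measure (𝓧 × (ℤ → E)), Q.map Prod.fst = μ ∧
      ∀ t ∈ Ico s (s + m), IsCompatibleAt g Q t := by
  induction m with
  | zero =>
    refine ⟨μ.map fun x => (x, fun _ => Classical.arbitrary E), ?_, by simp⟩
    rw [Measure.map_map measurable_fst measurable_prodMk_right]
    exact Measure.map_id
  | succ m ih =>
    obtain ⟨Q, hQfst, hQ⟩ := ih
    refine ⟨resample g (s + m) Q, by rw [map_fst_resample hg, hQfst], fun t ht => ?_⟩
    rcases (show t ≤ s + m by have := ht.2; push_cast at this; omega).lt_or_eq with h | rfl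
    · exact (hQ t ⟨ht.1, h⟩).resample hg h
    · exact isCompatibleAt_resample hg

end Resample

section Limit

lemma exists_measure_tendsto_of_isSetRing {α ι : Type*} [mα : MeasurableSpace α] {C : Set (Set α)}
    (hC : IsSetRing C) (hgen : mα = MeasurableSpace.generateFrom C) {ν : ι → Measure α}
    (u : Ultrafilter ι) {τ : Set α → ℝ≥0∞} (hτ : ∀ A ∈ C, τ A ≠ ∞)
    (hντ : ∀ i, ∀ A ∈ C, ν i A ≤ τ A)
    (hτ_empty : ∀ ⦃A : ℕ → Set α⦄, (∀ k, A k ∈ C) → Antitone A → ⋂ k, A k = ∅ →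
      Tendsto (fun k => τ (A k)) atTop (𝓝 0)) :
    ∃ ν' : Measure α, ∀ A ∈ C, Tendsto (fun i => ν i A) u (𝓝 (ν' A)) := by
  have hlim : ∀ A, ∃ a, Tendsto (fun i => ν i A) u (𝓝 a) := fun A =>
    (isCompact_univ.ultrafilter_le_nhds (u.map fun i => ν i A) (by simp)).imp fun a ha => ha.2
  choose L hL using hlim
  have hL_mem : ∀ {A B}, A ∈ C → B ∈ C → Disjoint A B → L (A ∪ B) = L A + L B :=
    fun {A B} _ hB hAB => by
      refine tendsto_nhds_unique (hL _) (((hL A).add (hL B)).congr fun i => ?_)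
      exact (measure_union hAB (hgen ▸ MeasurableSpace.measurableSet_generateFrom hB)).symm
  have hL_empty : L ∅ = 0 := tendsto_nhds_unique (hL ∅) (by simp)
  have hLτ : ∀ A ∈ C, L A ≤ τ A := fun A hA => le_of_tendsto' (hL A) fun i => hντ i A hA
  let m : AddContent ℝ≥0∞ C := hC.addContent_of_union L hL_empty hL_mem
  have hsub : m.IsSigmaSubadditive := isSigmaSubadditive_of_addContent_iUnion_eq_tsum hC
    (addContent_iUnion_eq_sum_of_tendsto_zero hC m
      (fun A hA => ((hLτ A hA).trans_lt (hτ A hA).lt_top).ne)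
      fun A hA hanti hA_empty => tendsto_of_tendsto_of_tendsto_of_le_of_le tendsto_const_nhds
        (hτ_empty hA hanti hA_empty) (fun _ => zero_le) fun k => hLτ _ (hA k))
  refine ⟨m.measure hC.isSetSemiring hgen.le hsub, fun A hA => ?_⟩
  rw [m.measure_eq hC.isSetSemiring hgen hsub hA]
  exact hL A

lemma lintegral_le_of_tendsto {α ι : Type*} {_ : MeasurableSpace α} {l : Filter ι} [l.NeBot]
    {ν : ι → Measure α} {ν' : Measure α}
    (h : ∀ A, MeasurableSet A → Tendsto (fun i => ν i A) l (𝓝 (ν' A))) {f : α → ℝ≥0∞}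
    {b : ι → ℝ≥0∞} {c : ℝ≥0∞} (hb : ∀ᶠ i in l, ∫⁻ a, f a ∂(ν i) ≤ b i)
    (hbc : Tendsto b l (𝓝 c)) : ∫⁻ a, f a ∂ν' ≤ c := by
  rw [lintegral_eq_nnreal]
  refine iSup₂_le fun φ hφ => ?_
  have hsum : ∀ ρ : Measure α, (φ.map ENNReal.ofNNReal).lintegral ρ =
      ∑ y ∈ φ.range, (y : ℝ≥0∞) * ρ (φ ⁻¹' {y}) := fun ρ => φ.map_lintegral _
  have hlim : Tendsto (fun i => (φ.map ENNReal.ofNNReal).lintegral (ν i)) l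
      (𝓝 ((φ.map ENNReal.ofNNReal).lintegral ν')) := by
    simp only [hsum]
    exact tendsto_finsetSum _ fun y _ =>
      ENNReal.Tendsto.const_mul (h _ (φ.measurableSet_fiber y)) (Or.inr ENNReal.coe_ne_top)
  refine le_of_tendsto_of_tendsto hlim hbc ?_
  filter_upwards [hb] with i hi
  rw [← SimpleFunc.lintegral_eq_lintegral]
  exact (lintegral_mono hφ).trans hi

variable {𝓧 E : Type*} [MeasurableSpace 𝓧] [MeasurableSpace E] [Finite E] {I : Set ℤ}

lemma measurableSet_image_fst [Nonempty E] (hI : I.Finite) {A : Set (𝓧 × (ℤ → E))}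
    (hA : MeasurableSet[window I] A) : MeasurableSet (Prod.fst '' A) := by
  have := hI.to_subtype
  let ext (w : I → E) : ℤ → E := Function.extend Subtype.val w fun _ => Classical.arbitrary E
  have himage : Prod.fst '' A = ⋃ w, {x | (x, ext w) ∈ A} := by
    ext x
    simp only [mem_image, Prod.exists, exists_and_right, exists_eq_right, mem_iUnion,
      mem_ofPred_eq]
    refine ⟨fun ⟨v, hv⟩ => ⟨fun s => v s, ?_⟩, fun ⟨w, hw⟩ => ⟨_, hw⟩⟩
    refine (mem_iff_of_measurableSet_window hA fun s hs => ?_).1 hv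
    exact (Subtype.val_injective.extend_apply (fun s : I => v s) _ ⟨s, hs⟩).symm
  rw [himage]
  exact .iUnion fun w => measurable_prodMk_right (window_le I A hA)

lemma iInter_image_fst_eq_empty {J : ℕ → Set ℤ} (hJ : ∀ k, (J k).Finite)
    {A : ℕ → Set (𝓧 × (ℤ → E))} (hA : ∀ k, A k ∈ localEvents J) (hanti : Antitone A)
    (hempty : ⋂ k, A k = ∅) : ⋂ k, Prod.fst '' A k = (∅ : Set 𝓧) := by
  let _ : TopologicalSpace E := ⊥
  have : DiscreteTopology E := ⟨rfl⟩
  by_contra hne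
  obtain ⟨x, hx⟩ := nonempty_iff_ne_empty.2 hne
  have hclosed : ∀ k, IsClosed {v | (x, v) ∈ A k} := fun k => by
    obtain ⟨i, B, -, hB⟩ := hA k
    have := (hJ i).to_subtype
    have hpre : {v | (x, v) ∈ A k} =
        (fun v : ℤ → E => fun s : J i => v s) ⁻¹' {w | (x, w) ∈ B} := by
      rw [← hB]; rfl
    rw [hpre]
    exact (isClosed_discrete _).preimage (by fun_prop)
  obtain ⟨v, hv⟩ := IsCompact.nonempty_iInter_of_sequence_nonempty_isCompact_isClosed
    (fun k => {v | (x, v) ∈ A k}) (fun k v hv => hanti k.le_succ hv)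
    (fun k => by
      obtain ⟨⟨x', v⟩, hv, rfl⟩ := mem_iInter.1 hx k
      exact ⟨v, hv⟩)
    (hclosed 0).isCompact hclosed
  have : (x, v) ∈ ⋂ k, A k := mem_iInter.2 fun k => mem_iInter.1 hv k
  simp [hempty] at this

lemma exists_measure_tendsto_localEvents [Nonempty E] {ι : Type*} {J : ℕ → Set ℤ}
    (hJ : Monotone J) (hJ_fin : ∀ k, (J k).Finite) (hU : ⋃ k, J k = univ) (u : Ultrafilter ι)
    (μ : Measure 𝓧) [IsFiniteMeasure μ] {ν : ι → Measure (𝓧 × (ℤ → E))}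
    (hν : ∀ i, (ν i).map Prod.fst = μ) :
    ∃ Q : Measure (𝓧 × (ℤ → E)), ∀ A ∈ localEvents J, Tendsto (fun i => ν i A) u (𝓝 (Q A)) := by
  refine exists_measure_tendsto_of_isSetRing (isSetRing_localEvents hJ)
    (by rw [generateFrom_localEvents, hU, window_univ]) u (τ := fun A => μ (Prod.fst '' A))
    (fun A _ => measure_ne_top _ _) (fun i A ⟨k, hA⟩ => ?_) fun A hA hanti hempty => ?_
  · rw [← hν i, Measure.map_apply measurable_fst (measurableSet_image_fst (hJ_fin k) hA)]
    exact measure_mono (subset_preimage_image _ _)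
  · have h := tendsto_measure_iInter_atTop (μ := μ) (s := fun k => Prod.fst '' A k)
      (fun k => by
        obtain ⟨i, hi⟩ := hA k
        exact (measurableSet_image_fst (hJ_fin i) hi).nullMeasurableSet)
      (fun _ _ h => image_mono (hanti h)) ⟨0, measure_ne_top _ _⟩
    rwa [iInter_image_fst_eq_empty hJ_fin hA hanti hempty, measure_empty] at h

end Limit

section Existence

lemma eq_of_le_of_sum_le {ι : Type*} [Fintype ι] {a b : ι → ℝ≥0∞} (hab : ∀ i, a i ≤ b i)
    (hb : ∑ i, b i ≠ ∞) (hsum : ∑ i, b i ≤ ∑ i, a i) (i : ι) : a i = b i := by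
  classical
  refine (hab i).antisymm ?_
  have hle : ∑ j ∈ Finset.univ.erase i, a j ≤ ∑ j ∈ Finset.univ.erase i, b j :=
    Finset.sum_le_sum fun j _ => hab j
  have hfin : ∑ j ∈ Finset.univ.erase i, a j ≠ ∞ := ne_top_of_le_ne_top hb
    (hle.trans (Finset.sum_le_sum_of_subset (Finset.erase_subset _ _)))
  rw [← ENNReal.add_le_add_iff_right hfin]
  calc b i + ∑ j ∈ Finset.univ.erase i, a j ≤ b i + ∑ j ∈ Finset.univ.erase i, b j := by gcongr
    _ = ∑ j, b j := Finset.add_sum_erase _ _ (Finset.mem_univ i)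
    _ ≤ ∑ j, a j := hsum
    _ = a i + ∑ j ∈ Finset.univ.erase i, a j := (Finset.add_sum_erase _ _ (Finset.mem_univ i)).symm

variable {𝓧 E : Type*} [MeasurableSpace 𝓧] [MeasurableSpace E] {Q : Measure (𝓧 × (ℤ → E))}

lemma setLIntegral_le_of_tendsto {ι : Type*} {l : Filter ι} [l.NeBot] {I : Set ℤ}
    {ν : ι → Measure (𝓧 × (ℤ → E))}
    (h : ∀ A, MeasurableSet[window I] A → Tendsto (fun i => ν i A) l (𝓝 (Q A)))
    {A : Set (𝓧 × (ℤ → E))} (hA : MeasurableSet[window I] A) {f : 𝓧 × (ℤ → E) → ℝ≥0∞}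
    (hf : Measurable[window I] f) {b : ι → ℝ≥0∞} {c : ℝ≥0∞}
    (hb : ∀ᶠ i in l, ∫⁻ z in A, f z ∂(ν i) ≤ b i) (hbc : Tendsto b l (𝓝 c)) :
    ∫⁻ z in A, f z ∂Q ≤ c := by
  have hle := window_le (𝓧 := 𝓧) (E := E) I
  have htrim : ∀ ρ : Measure (𝓧 × (ℤ → E)),
      ∫⁻ z in A, f z ∂ρ = ∫⁻ z, A.indicator f z ∂(ρ.trim hle) := fun ρ => by
    rw [lintegral_trim hle (hf.indicator hA), lintegral_indicator (hle A hA)]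
  simp only [htrim] at hb ⊢
  refine lintegral_le_of_tendsto (fun B hB => ?_) hb hbc
  simp only [trim_measurableSet_eq hle hB]
  exact h B hB

variable [Fintype E] [MeasurableSingletonClass E] {g : ℤ → E → 𝓧 × (ℤ → E) → ℝ≥0∞} {r : ℕ → ℝ}
  {t : ℤ}

lemma sum_measure_inter_category (A : Set (𝓧 × (ℤ → E))) :
    ∑ y, Q (A ∩ {z | z.2 t = y}) = Q A := by
  have h := sum_measure_preimage_singleton (μ := Q.restrict A) (f := fun z => z.2 t)
    Finset.univ fun y _ => measurableSet_category t y
  simp only [Finset.coe_univ, preimage_univ, Measure.restrict_apply_univ] at h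
  rw [← h]
  refine Finset.sum_congr rfl fun y _ => ?_
  rw [inter_comm, ← Measure.restrict_apply (measurableSet_category t y)]
  rfl

lemma isCompatibleAt_of_le [IsFiniteMeasure Q] (hg : IsTransition g r)
    (h : ∀ (y : E) (k : ℕ) (A : Set (𝓧 × (ℤ → E))), MeasurableSet[window (Ico (t - k) t)] A →
      ∫⁻ z in A, g t y z ∂Q ≤ Q (A ∩ {z | z.2 t = y})) : IsCompatibleAt g Q t := by
  have hmono : Monotone fun k : ℕ => Ico (t - k : ℤ) t := fun _ _ h =>
    Ico_subset_Ico_left (by omega)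
  have hU : ⋃ k : ℕ, Ico (t - k : ℤ) t = Iio t := by
    ext s
    simp only [mem_iUnion, mem_Ico, mem_Iio, exists_and_right, and_iff_right_iff_imp]
    exact fun h => ⟨(t - s).natAbs, by omega⟩
  intro y A hA
  have key : Q.restrict {z | z.2 t = y} A = Q.withDensity (g t y) A := by
    refine measure_eq_of_localEvents hmono ?_ (hU ▸ hA)
    rintro B ⟨k, hB⟩
    have hB' := window_le _ _ hB
    rw [Measure.restrict_apply hB', withDensity_apply _ hB']
    have hfin := measure_ne_top Q B
    rw [← sum_measure_inter_category (t := t) B] at hfin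
    refine (eq_of_le_of_sum_le (fun y => h y k B hB) hfin (le_of_eq ?_) y).symm
    rw [sum_measure_inter_category, hg.sum_setLIntegral]
  rwa [Measure.restrict_apply (window_le _ _ hA), withDensity_apply _ (window_le _ _ hA)] at key

/-- The transition probability is approximated by its version with a frozen distant past, which is
local, hence passes to the limit. -/
lemma isCompatibleAt_of_tendsto [Nonempty E] [IsFiniteMeasure Q] (hg : IsTransition g r)
    {ι : Type*} {l : Filter ι} [l.NeBot] {ν : ι → Measure (𝓧 × (ℤ → E))}
    (hν : ∀ᶠ i in l, IsCompatibleAt g (ν i) t)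
    (hlim : ∀ (k : ℕ) (A : Set (𝓧 × (ℤ → E))), MeasurableSet[window (Ico (t - k) (t + 1))] A →
      Tendsto (fun i => ν i A) l (𝓝 (Q A))) : IsCompatibleAt g Q t := by
  refine isCompatibleAt_of_le hg fun y j A hA => ?_
  let e (k : ℕ) : ℝ≥0∞ := ENNReal.ofReal (Real.exp (r k))
  have he : Tendsto (fun k => e k * (e k * Q (A ∩ {z | z.2 t = y}))) atTop
      (𝓝 (1 * (1 * Q (A ∩ {z | z.2 t = y})))) := by
    have h1 : Tendsto e atTop (𝓝 1) := by
      simpa using ENNReal.tendsto_ofReal (hg.summable.tendsto_atTop_zero.rexp)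
    exact ENNReal.Tendsto.mul h1 (by simp) (ENNReal.Tendsto.mul_const h1 (by simp)) (by simp)
  simp only [one_mul] at he
  refine ge_of_tendsto he ((eventually_ge_atTop j).mono fun k hk => ?_)
  have hA' : MeasurableSet[window (Ico (t - k) t)] A :=
    window_mono (Ico_subset_Ico_left (by omega)) _ hA
  let f (z : 𝓧 × (ℤ → E)) : 𝓧 × (ℤ → E) :=
    (z.1, (Ico (t - k) t).piecewise z.2 fun _ => Classical.arbitrary E)
  have hf : ∀ z : 𝓧 × (ℤ → E), EqOn (f z).2 z.2 (Ico (t - k) t) := fun z =>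
    piecewise_eqOn _ _ _
  have hgf : Measurable[window (Ico (t - k) t)] fun z => g t y (f z) :=
    (hg.measurable_prod t y).comp (measurable_window_piecewise _)
  have hlocal : ∫⁻ z in A, g t y (f z) ∂Q ≤ e k * Q (A ∩ {z | z.2 t = y}) := by
    have hAy : MeasurableSet[window (Ico (t - k) (t + 1))] (A ∩ {z | z.2 t = y}) :=
      MeasurableSet.inter (m := window (Ico (t - k) (t + 1)))
        (window_mono (Ico_subset_Ico_right (by omega)) _ hA')
        (measurable_eval_window (by simp only [mem_Ico]; omega) (measurableSet_singleton y))
    refine setLIntegral_le_of_tendsto (fun C hC => hlim k C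
      (window_mono (Ico_subset_Ico_right (by omega)) _ hC)) hA' hgf ?_
      (ENNReal.Tendsto.const_mul (hlim k _ hAy) (Or.inr ENNReal.ofReal_ne_top))
    filter_upwards [hν] with i hi
    rw [hi y A (window_mono Ico_subset_Iio_self _ hA), ← lintegral_const_mul' _ _
      ENNReal.ofReal_ne_top]
    exact lintegral_mono fun z => hg.distortion t y k z.1 _ _ (hf z)
  calc ∫⁻ z in A, g t y z ∂Q ≤ ∫⁻ z in A, e k * g t y (f z) ∂Q :=
        lintegral_mono fun z => hg.distortion t y k z.1 _ _ (hf z).symm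
    _ = e k * ∫⁻ z in A, g t y (f z) ∂Q := lintegral_const_mul' _ _ ENNReal.ofReal_ne_top
    _ ≤ e k * (e k * Q (A ∩ {z | z.2 t = y})) := by gcongr

theorem exists_isCompatible [Nonempty E] (hg : IsTransition g r) (μ : Measure 𝓧)
    [IsFiniteMeasure μ] : ∃ Q : Measure (𝓧 × (ℤ → E)), Q.map Prod.fst = μ ∧ IsCompatible g Q := by
  choose ν hν hνt using fun m : ℕ => exists_isCompatibleAt_Ico hg μ (-m) (2 * m)
  obtain ⟨Q, hQ⟩ := exists_measure_tendsto_localEvents monotone_Ico_neg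
    (fun m => finite_Ico _ _) iUnion_Ico_neg (hyperfilter ℕ) μ hν
  have hfst : Q.map Prod.fst = μ := by
    ext C hC
    have hC' : Prod.fst ⁻¹' C ∈ localEvents (E := E) fun m : ℕ => Ico (-m : ℤ) m :=
      ⟨0, measurable_fst_window _ hC⟩
    rw [Measure.map_apply measurable_fst hC]
    refine tendsto_nhds_unique (hQ _ hC') (tendsto_const_nhds.congr fun m => ?_)
    rw [← hν m, Measure.map_apply measurable_fst hC]
  have : IsFiniteMeasure Q := by
    refine ⟨?_⟩
    rw [← preimage_univ (f := Prod.fst), ← Measure.map_apply measurable_fst .univ, hfst]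
    exact measure_lt_top μ _
  refine ⟨Q, hfst, fun t => isCompatibleAt_of_tendsto hg (l := hyperfilter ℕ) (ν := ν) ?_ ?_⟩
  · refine Nat.hyperfilter_le_atTop ((eventually_gt_atTop t.natAbs).mono fun m hm => ?_)
    refine hνt m t ?_
    push_cast
    constructor <;> omega
  · exact fun k A hA => hQ A ⟨k + t.natAbs + 1, window_mono
      (Ico_subset_Ico (by omega) (by omega)) _ hA⟩

end Existence

section Stationarity

variable {𝓧 𝓧' E : Type*} [MeasurableSpace 𝓧] [MeasurableSpace 𝓧'] [MeasurableSpace E]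
  {g : ℤ → E → 𝓧 × (ℤ → E) → ℝ≥0∞} {g' : ℤ → E → 𝓧' × (ℤ → E) → ℝ≥0∞}
  {Q : Measure (𝓧 × (ℤ → E))}

lemma measurable_shift {S : Type*} [MeasurableSpace S] :
    Measurable (shift : (ℤ → S) → ℤ → S) := by
  unfold shift
  fun_prop

lemma IsTransition.comp_prodMap [Fintype E] {r : ℕ → ℝ} (hg : IsTransition g r) {ξ : 𝓧' → 𝓧}
    (hξ : Measurable ξ) : IsTransition (fun t y z => g t y (Prod.map ξ id z)) r where
  measurable t y := (hg.measurable t y).comp <| measurable_window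
    (hξ.comp (measurable_fst_window _)) fun _ hs => measurable_eval_window hs
  sum_eq_one t _ := hg.sum_eq_one t _
  nonneg := hg.nonneg
  summable := hg.summable
  distortion t y k _ v w hvw := hg.distortion t y k _ v w hvw

lemma IsCompatible.map [MeasurableSingletonClass E] {ξ : 𝓧' → 𝓧} (hξ : Measurable ξ)
    {Q' : Measure (𝓧' × (ℤ → E))} (hQ' : IsCompatible g' Q') {c : ℤ}
    (hgg' : ∀ t y z, g t y (ξ z.1, fun s => z.2 (s + c)) = g' (t + c) y z)
    (hg : ∀ t y, Measurable (g t y)) :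
    IsCompatible g (Q'.map fun z => (ξ z.1, fun s => z.2 (s + c))) := by
  have hΦ : Measurable fun z : 𝓧' × (ℤ → E) => (ξ z.1, fun s => z.2 (s + c)) :=
    measurable_of_coordinates (by fun_prop) (by fun_prop)
  intro t y A hA
  have hΦt : Measurable[window (Iio (t + c)), window (Iio t)]
      fun z : 𝓧' × (ℤ → E) => (ξ z.1, fun s => z.2 (s + c)) :=
    measurable_window (hξ.comp (measurable_fst_window _)) fun s hs =>
      measurable_eval_window (add_lt_add_left hs c)
  have hA' := window_le _ _ hA
  rw [Measure.map_apply hΦ (hA'.inter (measurableSet_category t y)),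
    setLIntegral_map hA' (hg t y) hΦ]
  simp only [hgg']
  exact hQ' (t + c) y _ (hΦt hA)

/-- The shift as a measurable equivalence. -/
def shiftEquiv (S : Type*) [MeasurableSpace S] : (ℤ → S) ≃ᵐ (ℤ → S) where
  toFun := shift
  invFun v s := v (s - 1)
  left_inv v := by ext; simp [shift]
  right_inv v := by ext; simp [shift]
  measurable_toFun := measurable_shift
  measurable_invFun := by simp only [Equiv.coe_fn_symm_mk]; fun_prop

/-- The joint shift of the environment, by `θ`, and of the categories. -/
def skewShift (θ : 𝓧 ≃ᵐ 𝓧) : 𝓧 × (ℤ → E) ≃ᵐ 𝓧 × (ℤ → E) :=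
  θ.prodCongr (shiftEquiv E)

variable {θ : 𝓧 ≃ᵐ 𝓧}

lemma map_fst_map_skewShift :
    (Q.map (skewShift θ)).map Prod.fst = (Q.map Prod.fst).map θ := by
  rw [Measure.map_map measurable_fst (skewShift θ).measurable,
    Measure.map_map θ.measurable measurable_fst]
  rfl

lemma measurableSet_preimage_symm_skewShift {t : ℤ} {B : Set (𝓧 × (ℤ → E))}
    (hB : MeasurableSet[window (Iio (t + 1))] B) :
    MeasurableSet[window (Iio t)] ((skewShift θ).symm ⁻¹' B) := by
  have h : Measurable[window (Iio t), window (Iio (t + 1))]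
      ((skewShift θ).symm : 𝓧 × (ℤ → E) → 𝓧 × (ℤ → E)) :=
    measurable_window (θ.symm.measurable.comp (measurable_fst_window _)) fun s hs =>
      measurable_eval_window (Int.sub_one_lt_iff.2 (Int.lt_add_one_iff.1 hs))
  exact h hB

lemma exists_measurableSet_window_symmDiff_lt [IsFiniteMeasure Q]
    (hQ : MeasurePreserving (skewShift θ) Q Q) {A : Set (𝓧 × (ℤ → E))} (hA : MeasurableSet A)
    (hA_inv : skewShift θ ⁻¹' A = A) (t : ℤ) {ε : ℝ≥0∞} (hε : 0 < ε) :
    ∃ B, MeasurableSet[window (Iio t)] B ∧ Q (symmDiff B A) < ε := by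
  have hstep : ∀ s, (∃ B, MeasurableSet[window (Iio (s + 1))] B ∧ Q (symmDiff B A) < ε) →
      ∃ B, MeasurableSet[window (Iio s)] B ∧ Q (symmDiff B A) < ε := by
    rintro s ⟨B, hB, hBA⟩
    refine ⟨_, measurableSet_preimage_symm_skewShift (θ := θ) hB, ?_⟩
    have hA_inv' : (skewShift θ).symm ⁻¹' A = A := by
      conv_lhs => rw [← hA_inv]
      exact (skewShift θ).toEquiv.symm_preimage_preimage A
    have hsymm := (hQ.symm (skewShift θ)).measure_preimage
      ((window_le _ _ hB).symmDiff hA).nullMeasurableSet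
    rw [preimage_symmDiff, hA_inv'] at hsymm
    rwa [hsymm]
  obtain ⟨B, ⟨k, hB⟩, hBA⟩ := exists_mem_localEvents_symmDiff_lt monotone_Ico_neg
    iUnion_Ico_neg Q hA hε
  have hk : ∀ i : ℕ, ∃ B, MeasurableSet[window (Iio ((k : ℤ) - i))] B ∧ Q (symmDiff B A) < ε := by
    intro i
    induction i with
    | zero => exact ⟨B, window_mono (by simp [Ico_subset_Iio_self]) _ hB, hBA⟩
    | succ i ih => exact hstep _ (by convert ih using 6; push_cast; ring)
  obtain ⟨C, hC, hCA⟩ := hk (k - t).natAbs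
  exact ⟨C, window_mono (Iio_subset_Iio (by omega)) _ hC, hCA⟩

variable [MeasurableSingletonClass E]

/-- An invariant event is approximated by events of the distant past, on which the compatibility
of the restriction is clear. -/
lemma IsCompatible.restrict [IsFiniteMeasure Q] (hQ : IsCompatible g Q)
    (hQθ : MeasurePreserving (skewShift θ) Q Q) {A : Set (𝓧 × (ℤ → E))} (hA : MeasurableSet A)
    (hA_inv : skewShift θ ⁻¹' A = A) (hle : ∀ t y z, g t y z ≤ 1) :
    IsCompatible g (Q.restrict A) := by
  intro t y C hC
  have hC' := window_le _ _ hC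
  have hνQ : Q.restrict (C ∩ {z | z.2 t = y}) ≤ Q := Measure.restrict_le_self
  have hν'Q : (Q.restrict C).withDensity (g t y) ≤ Q := by
    refine le_trans ?_ (Measure.restrict_le_self (s := C))
    conv_rhs => rw [← withDensity_one (μ := Q.restrict C)]
    exact withDensity_mono (ae_of_all _ (hle t y))
  have happrox : ∀ {ν ν' : Measure (𝓧 × (ℤ → E))}, ν ≤ Q → ν' ≤ Q →
      (∀ B, MeasurableSet[window (Iio t)] B → ν B = ν' B) → ν A ≤ ν' A := fun hν hν' h => by
    refine (measure_le_mul_of_forall_symmDiff_lt hν hν' ENNReal.one_ne_top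
      fun ε hε => ?_).trans_eq (one_mul _)
    obtain ⟨B, hB, hBA⟩ := exists_measurableSet_window_symmDiff_lt hQθ hA hA_inv t hε
    exact ⟨B, hBA, by rw [one_mul, h B hB]⟩
  have hB := fun B => (hQ t).restrict_category_apply y hC (C := B)
  have key := (happrox hνQ hν'Q hB).antisymm (happrox hν'Q hνQ fun B h => (hB B h).symm)
  rw [withDensity_apply _ hA, Measure.restrict_apply hA, Measure.restrict_restrict hA] at key
  rw [Measure.restrict_apply (hC'.inter (measurableSet_category t y)),
    Measure.restrict_restrict hC', inter_comm, key, inter_comm]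

variable [Fintype E] [Nonempty E] {r : ℕ → ℝ} [IsFiniteMeasure Q]

theorem IsCompatible.measurePreserving_skewShift (hg : IsTransition g r)
    (hgθ : ∀ t y z, g t y (skewShift θ z) = g (t + 1) y z) (hQ : IsCompatible g Q)
    (hθ : MeasurePreserving θ (Q.map Prod.fst) (Q.map Prod.fst)) :
    MeasurePreserving (skewShift θ) Q Q := by
  refine ⟨(skewShift θ).measurable, ?_⟩
  have hmap : IsCompatible g (Q.map (skewShift θ)) :=
    hQ.map θ.measurable hgθ hg.measurable_prod
  exact hmap.eq_of_map_fst_eq hg hQ (by rw [map_fst_map_skewShift, hθ.map_eq])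

lemma IsCompatible.exists_restrict_eq_smul (hg : IsTransition g r)
    (hgθ : ∀ t y z, g t y (skewShift θ z) = g (t + 1) y z) (hQ : IsCompatible g Q)
    (hθ : Ergodic θ (Q.map Prod.fst)) {A : Set (𝓧 × (ℤ → E))} (hA : MeasurableSet A)
    (hA_inv : skewShift θ ⁻¹' A = A) : ∃ c : ℝ≥0∞, Q.restrict A = c • Q := by
  have hQθ := hQ.measurePreserving_skewShift hg hgθ hθ.toMeasurePreserving
  have hQA := hQ.restrict hQθ hA hA_inv hg.le_one
  have hinv : MeasurePreserving (skewShift θ) (Q.restrict A) (Q.restrict A) := by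
    simpa only [hA_inv] using hQθ.restrict_preimage hA
  have hfst : MeasurePreserving θ ((Q.restrict A).map Prod.fst) ((Q.restrict A).map Prod.fst) :=
    ⟨θ.measurable, by rw [← map_fst_map_skewShift, hinv.map_eq]⟩
  obtain ⟨c, hc⟩ := hθ.eq_smul_of_absolutelyContinuous hfst
    (Measure.absolutelyContinuous_of_le (Measure.map_mono Measure.restrict_le_self measurable_fst))
  rcases eq_or_ne Q 0 with rfl | hQ0
  · exact ⟨0, by simp⟩
  have hc_top : c ≠ ∞ := by
    rintro rfl
    have huniv := congr($hc univ)
    rw [Measure.smul_apply, smul_eq_mul, Measure.map_apply measurable_fst .univ,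
      Measure.map_apply measurable_fst .univ, preimage_univ,
      ENNReal.top_mul (by simpa using hQ0)] at huniv
    exact measure_ne_top _ _ huniv
  have : IsFiniteMeasure (c • Q) := Q.smul_finite hc_top
  exact ⟨c, hQA.eq_of_map_fst_eq hg (hQ.smul c) (by rw [hc, Measure.map_smul])⟩

theorem IsCompatible.ergodic_skewShift (hg : IsTransition g r)
    (hgθ : ∀ t y z, g t y (skewShift θ z) = g (t + 1) y z) (hQ : IsCompatible g Q)
    (hθ : Ergodic θ (Q.map Prod.fst)) : Ergodic (skewShift θ) Q := by
  refine ⟨hQ.measurePreserving_skewShift hg hgθ hθ.toMeasurePreserving, ⟨fun A hA hA_inv => ?_⟩⟩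
  obtain ⟨c, hA_eq⟩ := hQ.exists_restrict_eq_smul hg hgθ hθ hA hA_inv
  have hcompl := congr($hA_eq Aᶜ)
  rw [Measure.restrict_apply hA.compl, compl_inter_self, measure_empty, Measure.smul_apply,
    smul_eq_mul, eq_comm, mul_eq_zero] at hcompl
  rw [eventuallyConst_set']
  rcases hcompl with rfl | hcompl
  · refine .inl (ae_eq_empty.2 ?_)
    simpa using congr($hA_eq A)
  · exact .inr (ae_eq_univ.2 hcompl)

end Stationarity

section GeometricDecay

/-- The powers of `a` are bounded by the geometric sequence `C * ρ ^ k`, with `0 < ρ < 1`. -/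
structure GeometricDecay {R : Type*} [NormedRing R] (a : R) (C ρ : ℝ) : Prop where
  rate_pos : 0 < ρ
  rate_lt_one : ρ < 1
  norm_pow_le : ∀ k : ℕ, ‖a ^ k‖ ≤ C * ρ ^ k

lemma GeometricDecay.const_nonneg {R : Type*} [NormedRing R] {a : R} {C ρ : ℝ}
    (ha : GeometricDecay a C ρ) : 0 ≤ C := by
  simpa using (norm_nonneg _).trans (ha.norm_pow_le 0)

lemma exists_geometricDecay_of_spectralRadius_lt_one {R : Type*} [NormedRing R]
    [NormedAlgebra ℂ R] [CompleteSpace R] {a : R} (ha : spectralRadius ℂ a < 1) :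
    ∃ C ρ : ℝ, GeometricDecay a C ρ := by
  obtain ⟨ρ, haρ, hρ1⟩ := ENNReal.lt_iff_exists_nnreal_btwn.1 ha
  have hρ0 : 0 < ρ := ENNReal.coe_pos.1 (bot_le.trans_lt haρ)
  have hbound : ∀ᶠ k : ℕ in atTop, ‖a ^ k‖ ≤ 1 * ‖(ρ : ℝ) ^ k‖ := by
    have hgelfand := spectrum.pow_nnnorm_pow_one_div_tendsto_nhds_spectralRadius a
    filter_upwards [hgelfand.eventually_lt_const haρ, eventually_ne_atTop 0] with k hk hk0
    rw [one_div, ENNReal.rpow_inv_lt_iff (by positivity), ENNReal.rpow_natCast] at hk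
    rw [one_mul, Real.norm_of_nonneg (by positivity)]
    exact_mod_cast hk.le
  obtain ⟨C, -, hC⟩ := Asymptotics.bound_of_isBigO_nat_atTop (Asymptotics.IsBigO.of_bound 1 hbound)
  refine ⟨C, ρ, hρ0, by exact_mod_cast hρ1, fun k => ?_⟩
  simpa using hC (pow_ne_zero k (NNReal.coe_ne_zero.2 hρ0.ne'))

variable {V : Type*} [NormedAddCommGroup V] [NormedSpace ℝ V] {T : V →L[ℝ] V} {C ρ : ℝ}

lemma GeometricDecay.norm_pow_apply_le (hT : GeometricDecay T C ρ) (k : ℕ) (v : V) :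
    ‖(T ^ k) v‖ ≤ C * ρ ^ k * ‖v‖ :=
  (T ^ k).le_of_opNorm_le (hT.norm_pow_le k) v

lemma GeometricDecay.tendsto_pow_apply (hT : GeometricDecay T C ρ) (v : V) :
    Tendsto (fun k => (T ^ k) v) atTop (𝓝 0) := by
  refine squeeze_zero_norm (hT.norm_pow_apply_le · v) ?_
  simpa using ((tendsto_pow_atTop_nhds_zero_of_lt_one hT.rate_pos.le hT.rate_lt_one).const_mul
    C).mul_const ‖v‖

/-- The causal solution `s t = ∑ k, T ^ k (w (t - k))` of the recursion `s t = w t + T (s (t - 1))`,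
with value `0` where the series diverges. -/
def causalSum (T : V →L[ℝ] V) (w : ℤ → V) (t : ℤ) : V := ∑' k : ℕ, (T ^ k) (w (t - k))

lemma causalSum_eq_add {w : ℤ → V} {t : ℤ}
    (hw : ∀ t, Summable fun k : ℕ => (T ^ k) (w (t - k))) :
    causalSum T w t = w t + T (causalSum T w (t - 1)) := by
  rw [causalSum, (hw t).tsum_eq_zero_add, causalSum, T.map_tsum (hw (t - 1))]
  congr 1
  · simp
  · refine tsum_congr fun k => ?_
    rw [pow_succ', mul_apply_eq_comp]
    congr 3
    push_cast
    ring

variable [CompleteSpace V]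

lemma GeometricDecay.summable_of_le (hT : GeometricDecay T C ρ) {w : ℤ → V} {t : ℤ} {M τ : ℝ}
    (hτ : 0 ≤ τ) (hτρ : τ * ρ < 1) (hw : ∀ᶠ k : ℕ in atTop, ‖w (t - k)‖ ≤ M * τ ^ k) :
    Summable fun k : ℕ => (T ^ k) (w (t - k)) := by
  have hgeom : Summable fun k : ℕ => C * M * (τ * ρ) ^ k :=
    (summable_geometric_of_lt_one (mul_nonneg hτ hT.rate_pos.le) hτρ).mul_left _
  refine hgeom.of_norm_bounded_eventually_nat ?_
  filter_upwards [hw] with k hk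
  have := hT.const_nonneg
  have := hT.rate_pos
  calc ‖(T ^ k) (w (t - k))‖ ≤ C * ρ ^ k * ‖w (t - k)‖ := hT.norm_pow_apply_le k _
    _ ≤ C * ρ ^ k * (M * τ ^ k) := by gcongr
    _ = C * M * (τ * ρ) ^ k := by rw [mul_pow]; ring

lemma GeometricDecay.norm_causalSum_le (hT : GeometricDecay T C ρ) {w : ℤ → V} {t : ℤ}
    {M : ℝ} (hM : ∀ s, ‖w s‖ ≤ M) (m : ℕ) (hw : EqOn w 0 (Ioc (t - m) t)) :
    ‖causalSum T w t‖ ≤ C * M / (1 - ρ) * ρ ^ m := by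
  have := hT.const_nonneg
  have := hT.rate_pos
  have hsum : Summable fun k : ℕ => (T ^ k) (w (t - k)) :=
    hT.summable_of_le zero_le_one (by simpa using hT.rate_lt_one) (M := M)
      (.of_forall fun k => by simpa using hM (t - k))
  have hinit : ∀ k ∈ Finset.range m, (T ^ k) (w (t - k)) = 0 := fun k hk => by
    rw [hw (by have := Finset.mem_range.1 hk; simp only [mem_Ioc]; omega), Pi.zero_apply, map_zero]
  rw [causalSum, ← hsum.sum_add_tsum_nat_add m, Finset.sum_eq_zero hinit, zero_add,
    show C * M / (1 - ρ) * ρ ^ m = C * M * ρ ^ m * (1 - ρ)⁻¹ by ring]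
  refine tsum_of_norm_bounded
    ((hasSum_geometric_of_lt_one hT.rate_pos.le hT.rate_lt_one).mul_left _) fun k => ?_
  calc ‖(T ^ (k + m)) (w (t - (k + m : ℕ)))‖
      ≤ C * ρ ^ (k + m) * ‖w (t - (k + m : ℕ))‖ := hT.norm_pow_apply_le _ _
    _ ≤ C * ρ ^ (k + m) * M := by gcongr; exact hM _
    _ = C * M * ρ ^ m * ρ ^ k := by rw [pow_add]; ring

lemma GeometricDecay.norm_causalSum_sub_le (hT : GeometricDecay T C ρ) {w w' : ℤ → V} {t : ℤ}
    {M : ℝ} (hM : ∀ s, ‖w s - w' s‖ ≤ M) (m : ℕ) (hww' : EqOn w w' (Ioc (t - m) t)) :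
    ‖causalSum T w t - causalSum T w' t‖ ≤ C * M / (1 - ρ) * ρ ^ m := by
  have hterm : ∀ k : ℕ, (T ^ k) ((w - w') (t - k)) = (T ^ k) (w (t - k)) - (T ^ k) (w' (t - k)) :=
    fun k => map_sub _ _ _
  have hsub : Summable fun k : ℕ => (T ^ k) ((w - w') (t - k)) :=
    hT.summable_of_le zero_le_one (by simpa using hT.rate_lt_one) (M := M)
      (.of_forall fun k => by simpa using hM (t - k))
  by_cases hw' : Summable fun k : ℕ => (T ^ k) (w' (t - k))
  · have hw : Summable fun k : ℕ => (T ^ k) (w (t - k)) := by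
      simpa only [hterm, sub_add_cancel] using hsub.add hw'
    have hdiff : causalSum T w t - causalSum T w' t = causalSum T (w - w') t := by
      simp only [causalSum, hterm, hw.tsum_sub hw']
    rw [hdiff]
    exact hT.norm_causalSum_le hM m fun s hs => sub_eq_zero.2 (hww' hs)
  · have hw : ¬ Summable fun k : ℕ => (T ^ k) (w (t - k)) := fun hw => hw' <| by
      simpa only [hterm, sub_sub_cancel] using hw.sub hsub
    have := hT.const_nonneg
    have := hT.rate_pos
    have h1ρ : 0 < 1 - ρ := sub_pos.2 hT.rate_lt_one
    have hM0 : 0 ≤ M := (norm_nonneg _).trans (hM 0)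
    rw [causalSum, causalSum, tsum_eq_zero_of_not_summable hw, tsum_eq_zero_of_not_summable hw',
      sub_zero, norm_zero]
    positivity

end GeometricDecay

section Companion

variable {n q : ℕ} {𝕜 : Type*} [RCLike 𝕜]

/-- The block companion operator of the lag matrices `B`: it maps `(λ_{t-1}, …, λ_{t-q-1})` to
`(∑ j, B j λ_{t-1-j}, λ_{t-1}, …, λ_{t-q})`. The state has one block more than there are lags, so
that it exists for `q = 0`. -/
def companion (B : Fin q → Matrix (Fin n) (Fin n) 𝕜) :
    (Fin (q + 1) → Fin n → 𝕜) →L[𝕜] Fin (q + 1) → Fin n → 𝕜 :=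
  LinearMap.toContinuousLinearMap <| LinearMap.pi <| Fin.cons
    (α := fun _ => (Fin (q + 1) → Fin n → 𝕜) →ₗ[𝕜] Fin n → 𝕜)
    (∑ j, (B j).mulVecLin ∘ₗ LinearMap.proj j.castSucc) fun j => LinearMap.proj j.castSucc

lemma companion_apply_zero (B : Fin q → Matrix (Fin n) (Fin n) 𝕜) (w : Fin (q + 1) → Fin n → 𝕜) :
    companion B w 0 = ∑ j, (B j).mulVec (w j.castSucc) := by
  simp [companion, LinearMap.sum_apply]

lemma companion_apply_succ (B : Fin q → Matrix (Fin n) (Fin n) 𝕜) (w : Fin (q + 1) → Fin n → 𝕜)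
    (j : Fin q) : companion B w j.succ = w j.castSucc := by
  simp [companion]

lemma eq_inv_pow_smul_of_companion_eq_smul {B : Fin q → Matrix (Fin n) (Fin n) 𝕜} {μ : 𝕜}
    (hμ : μ ≠ 0) {w : Fin (q + 1) → Fin n → 𝕜} (h : companion B w = μ • w) (j : Fin (q + 1)) :
    w j = μ⁻¹ ^ (j : ℕ) • w 0 := by
  induction j using Fin.induction with
  | zero => simp
  | succ j ih =>
    have hj := congrFun h j.succ
    rw [companion_apply_succ, ih, Pi.smul_apply, eq_comm, ← eq_inv_smul_iff₀ hμ, smul_smul] at hj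
    rw [hj, Fin.val_succ, Fin.val_castSucc, pow_succ']

lemma charFun_inv_eq_zero_of_eigenvector (B : Fin q → Matrix (Fin n) (Fin n) ℝ) {μ : ℂ}
    (hμ : μ ≠ 0) {w : Fin (q + 1) → Fin n → ℂ} (hw : w ≠ 0)
    (h : companion (fun j => (B j).map (algebraMap ℝ ℂ)) w = μ • w) : charFun B μ⁻¹ = 0 := by
  have hpow := eq_inv_pow_smul_of_companion_eq_smul hμ h
  have hw0 : w 0 ≠ 0 := fun h0 => hw <| funext fun j => by rw [hpow, h0, smul_zero, Pi.zero_apply]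
  have h0 := congrFun h 0
  rw [companion_apply_zero, Pi.smul_apply] at h0
  rw [charFun, ← Matrix.exists_mulVec_eq_zero_iff]
  refine ⟨w 0, hw0, ?_⟩
  rw [Matrix.sub_mulVec, Matrix.one_mulVec, Matrix.sum_mulVec, sub_eq_zero]
  calc w 0 = μ⁻¹ • ∑ j : Fin q, ((B j).map (algebraMap ℝ ℂ)).mulVec (w j.castSucc) := by
        rw [h0, inv_smul_smul₀ hμ]
    _ = ∑ j : Fin q, (μ⁻¹ ^ ((j : ℕ) + 1) • (B j).map (algebraMap ℝ ℂ)).mulVec (w 0) := by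
        rw [Finset.smul_sum]
        refine Finset.sum_congr rfl fun j _ => ?_
        rw [hpow, Matrix.mulVec_smul, smul_smul, Matrix.smul_mulVec, Fin.val_castSucc, pow_succ']

lemma spectralRadius_companion_lt_one {B : Fin q → Matrix (Fin n) (Fin n) ℝ}
    (hB : ∀ z : ℂ, charFun B z = 0 → 1 < ‖z‖) :
    spectralRadius ℂ (companion fun j => (B j).map (algebraMap ℝ ℂ)) < 1 := by
  set T := companion fun j => (B j).map (algebraMap ℝ ℂ)
  have hspec : ∀ μ ∈ spectrum ℂ T, ‖μ‖₊ < 1 := by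
    intro μ hμ
    rw [← AlgEquiv.spectrum_eq (Module.End.toContinuousLinearMap _).symm,
      ← Module.End.hasEigenvalue_iff_mem_spectrum] at hμ
    obtain ⟨w, hw⟩ := hμ.exists_hasEigenvector
    rcases eq_or_ne μ 0 with rfl | hμ0
    · simp
    have hroot := hB _ (charFun_inv_eq_zero_of_eigenvector B hμ0 hw.2 hw.apply_eq_smul)
    rw [norm_inv, one_lt_inv₀ (norm_pos_iff.2 hμ0)] at hroot
    exact_mod_cast hroot
  rcases subsingleton_or_nontrivial ((Fin (q + 1) → Fin n → ℂ) →L[ℂ] (Fin (q + 1) → Fin n → ℂ))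
  · simp [spectrum.SpectralRadius.of_subsingleton]
  · exact_mod_cast spectrum.spectralRadius_lt_of_forall_lt T (r := 1) hspec

/-- The inclusion of the real states into the complex ones. -/
def complexify (w : Fin (q + 1) → Fin n → ℝ) : Fin (q + 1) → Fin n → ℂ := fun j i => w j i

lemma norm_complexify (w : Fin (q + 1) → Fin n → ℝ) : ‖complexify w‖ = ‖w‖ := by
  simp [complexify, Pi.norm_def, Pi.nnnorm_def]

lemma companion_complexify (B : Fin q → Matrix (Fin n) (Fin n) ℝ) (w : Fin (q + 1) → Fin n → ℝ) :
    companion (fun j => (B j).map (algebraMap ℝ ℂ)) (complexify w) =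
      complexify (companion B w) := by
  ext j i
  cases j using Fin.cases with
  | zero =>
    simp [companion_apply_zero, complexify, Matrix.mulVec, dotProduct, Finset.sum_apply]
  | succ j => simp only [companion_apply_succ, complexify]

lemma companion_pow_complexify (B : Fin q → Matrix (Fin n) (Fin n) ℝ) (k : ℕ)
    (w : Fin (q + 1) → Fin n → ℝ) :
    (companion (fun j => (B j).map (algebraMap ℝ ℂ)) ^ k) (complexify w) =
      complexify ((companion B ^ k) w) := by
  rw [FunLike.coe_pow_eq_iterate, FunLike.coe_pow_eq_iterate]
  exact (Function.Semiconj.iterate_right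
    (fun w => (companion_complexify B w).symm) k w).symm

theorem exists_geometricDecay_companion {B : Fin q → Matrix (Fin n) (Fin n) ℝ}
    (hB : ∀ z : ℂ, charFun B z = 0 → 1 < ‖z‖) : ∃ C ρ : ℝ, GeometricDecay (companion B) C ρ := by
  obtain ⟨C, ρ, hT⟩ :=
    exists_geometricDecay_of_spectralRadius_lt_one (spectralRadius_companion_lt_one hB)
  have := hT.const_nonneg
  have := hT.rate_pos
  refine ⟨C, ρ, hT.rate_pos, hT.rate_lt_one, fun k =>
    ContinuousLinearMap.opNorm_le_bound _ (by positivity) fun w => ?_⟩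
  rw [← norm_complexify, ← norm_complexify w, ← companion_pow_complexify]
  exact ContinuousLinearMap.le_of_opNorm_le _ (hT.norm_pow_le k) _

end Companion

section CatProb

variable {n : ℕ}

/-- The multinomial logistic probabilities of all categories, including the reference one. -/
def catProb (l : Fin n → ℝ) (y : Fin (n + 1)) : ℝ :=
  Real.exp (Fin.cons (α := fun _ => ℝ) 0 l y) / (1 + ∑ j, Real.exp (l j))

lemma catProb_succ (l : Fin n → ℝ) (i : Fin n) : catProb l i.succ = logit l i := by
  simp [catProb, logit]

lemma one_add_sum_exp_pos (l : Fin n → ℝ) : 0 < 1 + ∑ j, Real.exp (l j) := by positivity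

lemma catProb_pos (l : Fin n → ℝ) (y : Fin (n + 1)) : 0 < catProb l y :=
  div_pos (Real.exp_pos _) (one_add_sum_exp_pos l)

lemma sum_catProb (l : Fin n → ℝ) : ∑ y, catProb l y = 1 := by
  simp only [catProb]
  rw [← Finset.sum_div, Fin.sum_univ_succ]
  simp only [Fin.cons_zero, Real.exp_zero, Fin.cons_succ]
  exact div_self (one_add_sum_exp_pos l).ne'

lemma norm_catProb_le_one (l : Fin n → ℝ) (y : Fin (n + 1)) : ‖catProb l y‖ ≤ 1 := by
  rw [Real.norm_of_nonneg (catProb_pos l y).le, ← sum_catProb l]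
  exact Finset.single_le_sum (fun y _ => (catProb_pos l y).le) (Finset.mem_univ y)

lemma catProb_zero (l : Fin n → ℝ) : catProb l 0 = 1 - ∑ i, logit l i := by
  simp only [← catProb_succ, ← sum_catProb l, Fin.sum_univ_succ, add_sub_cancel_right]

lemma measurable_catProb (y : Fin (n + 1)) : Measurable fun l : Fin n → ℝ => catProb l y := by
  unfold catProb
  cases y using Fin.cases with
  | zero => simp only [Fin.cons_zero]; fun_prop
  | succ i => simp only [Fin.cons_succ]; fun_prop

lemma catProb_le_exp_mul {l l' : Fin n → ℝ} {δ : ℝ} (h : ‖l - l'‖ ≤ δ) (y : Fin (n + 1)) :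
    catProb l y ≤ Real.exp (2 * δ) * catProb l' y := by
  have hδ : 0 ≤ δ := (norm_nonneg _).trans h
  have hcoord (i : Fin n) : |l i - l' i| ≤ δ := (norm_le_pi_norm (l - l') i).trans h
  have hnum : Real.exp (Fin.cons (α := fun _ => ℝ) 0 l y) ≤
      Real.exp δ * Real.exp (Fin.cons (α := fun _ => ℝ) 0 l' y) := by
    rw [← Real.exp_add, Real.exp_le_exp]
    cases y using Fin.cases with
    | zero => simpa using hδ
    | succ i =>
      simp only [Fin.cons_succ]
      linarith [(abs_le.1 (hcoord i)).2]
  have hden : 1 + ∑ j, Real.exp (l' j) ≤ Real.exp δ * (1 + ∑ j, Real.exp (l j)) := by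
    rw [mul_add, mul_one, Finset.mul_sum]
    refine add_le_add (Real.one_le_exp hδ) (Finset.sum_le_sum fun j _ => ?_)
    rw [← Real.exp_add, Real.exp_le_exp]
    linarith [(abs_le.1 (hcoord j)).1]
  rw [catProb, catProb, two_mul, Real.exp_add, mul_div_assoc',
    div_le_div_iff₀ (one_add_sum_exp_pos l) (one_add_sum_exp_pos l')]
  exact (mul_le_mul hnum hden (one_add_sum_exp_pos l').le (by positivity)).trans_eq (by ring)

/-- The inverse of the multinomial logistic map, which recovers the latent variable from the
probabilities of the non-reference categories. -/
def logitInv (a : Fin n → ℝ) : Fin n → ℝ := fun i => Real.log (a i / (1 - ∑ j, a j))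

lemma measurable_logitInv : Measurable (logitInv (n := n)) := by
  unfold logitInv
  fun_prop

lemma logitInv_logit (l : Fin n → ℝ) : logitInv (logit l) = l := by
  funext i
  rw [logitInv, ← catProb_zero, catProb, logit,
    div_div_div_cancel_right₀ (one_add_sum_exp_pos l).ne']
  simp

end CatProb

section LogMoment

lemma measurePreserving_translate {S : Type*} [MeasurableSpace S] {μ : Measure (ℤ → S)}
    (hμ : MeasurePreserving shift μ μ) (c : ℤ) :
    MeasurePreserving (fun (x : ℤ → S) s => x (s + c)) μ μ := by
  have hinv : MeasurePreserving (shiftEquiv S).symm μ μ :=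
    MeasurePreserving.symm (shiftEquiv S) hμ
  induction c using Int.induction_on with
  | zero =>
    simp only [add_zero]
    exact MeasurePreserving.id μ
  | succ c hc =>
    convert! hμ.comp hc using 2 with x
    funext s
    simp only [Function.comp_apply, shift]
    ring_nf
  | pred c hc =>
    convert! hinv.comp hc using 2 with x
    funext s
    change x _ = x (s - 1 + -c)
    ring_nf

variable {V : Type*} [NormedAddCommGroup V] [MeasurableSpace V] [OpensMeasurableSpace V]

lemma ae_eventually_norm_le_pow {μ : Measure (ℤ → V)} [IsProbabilityMeasure μ]
    (hμ : MeasurePreserving shift μ μ) {s₀ : ℤ}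
    (hlog : Integrable (fun x : ℤ → V => Real.posLog ‖x s₀‖) μ) {τ : ℝ} (hτ : 1 < τ) (t : ℤ) :
    ∀ᵐ x ∂μ, ∀ᶠ k : ℕ in atTop, ‖x (t - k)‖ ≤ τ ^ k := by
  have hlogτ : 0 < Real.log τ := Real.log_pos hτ
  set f : (ℤ → V) → ℝ := fun x => Real.posLog ‖x s₀‖ / Real.log τ with hf
  have hfm : Measurable f := by
    unfold f Real.posLog
    fun_prop
  let _ : MeasureSpace (ℤ → V) := ⟨μ⟩
  have : IsProbabilityMeasure (volume : Measure (ℤ → V)) := ‹IsProbabilityMeasure μ›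
  have hsum : ∑' k : ℕ, μ (f ⁻¹' Ioi (k : ℝ)) < ∞ :=
    tsum_prob_mem_Ioi_lt_top (hlog.div_const _) fun x => div_nonneg Real.posLog_nonneg hlogτ.le
  have hsum' : ∑' k : ℕ, μ ((fun x s => x (s + (t - k - s₀))) ⁻¹' (f ⁻¹' Ioi (k : ℝ))) ≠ ∞ := by
    simpa only [(measurePreserving_translate hμ _).measure_preimage
      (hfm measurableSet_Ioi).nullMeasurableSet] using hsum.ne
  filter_upwards [ae_eventually_notMem hsum'] with x hx
  filter_upwards [hx] with k hk
  simp only [hf, mem_preimage, mem_Ioi, not_lt, div_le_iff₀ hlogτ, add_sub_cancel] at hk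
  calc ‖x (t - k)‖ ≤ Real.exp (Real.log ‖x (t - k)‖) := Real.le_exp_log _
    _ ≤ Real.exp (k * Real.log τ) := Real.exp_le_exp.2 ((le_max_right _ _).trans hk)
    _ = τ ^ k := by rw [Real.exp_nat_mul, Real.exp_log (by positivity)]

end LogMoment

section Latent

variable {n d p q : ℕ} (B : Fin q → Matrix (Fin n) (Fin n) ℝ)
  (A : Fin p → Matrix (Fin n) (Fin n) ℝ) (Γ : Matrix (Fin n) (Fin d) ℝ)

/-- The contribution of the previous categories to the recursion for the latent process. -/
def categoryInput (v : ℤ → Fin (n + 1)) (t : ℤ) : Fin n → ℝ :=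
  ∑ l : Fin p, (A l).mulVec (dummy (v (t - ((l : ℤ) + 1))))

/-- The forcing term of the recursion for the latent process, as a function of the trajectories of
the covariates and of the categories. -/
def input (t : ℤ) (z : (ℤ → Fin d → ℝ) × (ℤ → Fin (n + 1))) : Fin n → ℝ :=
  categoryInput A z.2 t + Γ.mulVec (z.1 t)

/-- The vector `(λ_t, …, λ_{t-q})` of the latest latent variables, as a function of the trajectories
of the covariates and of the categories; it is `0` where the series diverges. -/
def latentState (t : ℤ) (z : (ℤ → Fin d → ℝ) × (ℤ → Fin (n + 1))) : Fin (q + 1) → Fin n → ℝ :=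
  causalSum (companion B) (fun s => Pi.single 0 (input A Γ s z)) t

/-- The latent process `λ_t` as a function of the trajectories of the covariates and of the
categories. -/
def latent (t : ℤ) (z : (ℤ → Fin d → ℝ) × (ℤ → Fin (n + 1))) : Fin n → ℝ :=
  latentState B A Γ t z 0

/-- The series which define the latent process converge. -/
def LatentSummable (z : (ℤ → Fin d → ℝ) × (ℤ → Fin (n + 1))) : Prop :=
  ∀ t : ℤ, Summable fun k : ℕ =>
    (companion B ^ k) (Pi.single 0 (input A Γ (t - k) z) : Fin (q + 1) → Fin n → ℝ)

variable {B A Γ}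

lemma categoryInput_congr {v w : ℤ → Fin (n + 1)} {t : ℤ} (h : EqOn v w (Ico (t - p) t)) :
    categoryInput A v t = categoryInput A w t :=
  Finset.sum_congr rfl fun l _ => by rw [h ⟨by omega, by omega⟩]

variable (A) in
lemma exists_norm_categoryInput_le :
    ∃ M : ℝ, 0 ≤ M ∧ ∀ (v : ℤ → Fin (n + 1)) (t : ℤ), ‖categoryInput A v t‖ ≤ M := by
  refine ⟨∑ l : Fin p, ∑ y, ‖(A l).mulVec (dummy y)‖, by positivity, fun v t => ?_⟩
  refine (norm_sum_le _ _).trans (Finset.sum_le_sum fun l _ => ?_)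
  exact Finset.single_le_sum (f := fun y => ‖(A l).mulVec (dummy y)‖) (fun _ _ => norm_nonneg _)
    (Finset.mem_univ _)

lemma LatentSummable.latentState_eq {z : (ℤ → Fin d → ℝ) × (ℤ → Fin (n + 1))}
    (hz : LatentSummable B A Γ z) (t : ℤ) :
    latentState B A Γ t z =
      Pi.single 0 (input A Γ t z) + companion B (latentState B A Γ (t - 1) z) :=
  causalSum_eq_add hz

lemma LatentSummable.latentState_apply {z : (ℤ → Fin d → ℝ) × (ℤ → Fin (n + 1))}
    (hz : LatentSummable B A Γ z) (t : ℤ) (j : Fin (q + 1)) :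
    latentState B A Γ t z j = latent B A Γ (t - j) z := by
  induction j using Fin.induction generalizing t with
  | zero => simp [latent]
  | succ j ih =>
    rw [hz.latentState_eq, Pi.add_apply, Pi.single_eq_of_ne (Fin.succ_ne_zero j), zero_add,
      companion_apply_succ, ih, Fin.val_castSucc, Fin.val_succ]
    congr 1
    push_cast
    ring

lemma LatentSummable.latent_recursion {z : (ℤ → Fin d → ℝ) × (ℤ → Fin (n + 1))}
    (hz : LatentSummable B A Γ z) (t : ℤ) :
    latent B A Γ t z =
      ∑ j : Fin q, (B j).mulVec (latent B A Γ (t - ((j : ℤ) + 1)) z) + input A Γ t z := by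
  rw [latent, hz.latentState_eq, Pi.add_apply, Pi.single_eq_same, companion_apply_zero, add_comm]
  simp only [hz.latentState_apply, Fin.val_castSucc, sub_sub, add_comm (1 : ℤ)]

lemma input_translate (t c : ℤ) (z : (ℤ → Fin d → ℝ) × (ℤ → Fin (n + 1))) :
    input A Γ t (fun s => z.1 (s + c), fun s => z.2 (s + c)) = input A Γ (t + c) z := by
  simp only [input, categoryInput, add_sub_right_comm t c]

lemma latent_translate (t c : ℤ) (z : (ℤ → Fin d → ℝ) × (ℤ → Fin (n + 1))) :
    latent B A Γ t (fun s => z.1 (s + c), fun s => z.2 (s + c)) = latent B A Γ (t + c) z := by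
  simp only [latent, latentState, causalSum, input_translate, add_sub_right_comm t c]

lemma measurable_input {α : Type*} {m : MeasurableSpace α}
    {f : α → (ℤ → Fin d → ℝ) × (ℤ → Fin (n + 1))} {t : ℤ}
    (hx : Measurable fun a => (f a).1 t) (hv : ∀ s < t, Measurable fun a => (f a).2 s) :
    Measurable fun a => input A Γ t (f a) := by
  refine Measurable.add (Finset.measurable_sum _ fun l _ => ?_) ?_
  · exact (measurable_of_finite fun y => (A l).mulVec (dummy y)).comp (hv _ (by omega))
  · have hΓ : Continuous fun x : Fin d → ℝ => Γ.mulVec x := by fun_prop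
    exact hΓ.measurable.comp hx

lemma measurable_latent_comp {α : Type*} {m : MeasurableSpace α}
    {f : α → (ℤ → Fin d → ℝ) × (ℤ → Fin (n + 1))} {t : ℤ}
    (hx : ∀ s ≤ t, Measurable fun a => (f a).1 s) (hv : ∀ s < t, Measurable fun a => (f a).2 s) :
    Measurable fun a => latent B A Γ t (f a) := by
  refine (measurable_pi_apply 0).comp (Measurable.tsum fun k => ?_)
  have hcont : Continuous fun u : Fin n → ℝ =>
      (companion B ^ k) (Pi.single 0 u : Fin (q + 1) → Fin n → ℝ) :=
    (companion B ^ k).continuous.comp (continuous_single (A := fun _ => Fin n → ℝ) 0)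
  exact hcont.measurable.comp <| measurable_input (hx _ (by omega)) fun s hs => hv s (by omega)

lemma measurable_latent (t : ℤ) : Measurable (latent B A Γ t) :=
  measurable_latent_comp (fun _ _ => by fun_prop) fun _ _ => by fun_prop

variable (A Γ) in
lemma exists_norm_latent_sub_le (hB : ∀ z : ℂ, charFun B z = 0 → 1 < ‖z‖) :
    ∃ K ρ : ℝ, 0 ≤ K ∧ 0 ≤ ρ ∧ ρ < 1 ∧ ∀ (t : ℤ) (k : ℕ) (x : ℤ → Fin d → ℝ)
      (v w : ℤ → Fin (n + 1)), EqOn v w (Ico (t - k) t) →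
        ‖latent B A Γ t (x, v) - latent B A Γ t (x, w)‖ ≤ K * ρ ^ (k - p) := by
  obtain ⟨C, ρ, hT⟩ := exists_geometricDecay_companion hB
  obtain ⟨M, hM0, hM⟩ := exists_norm_categoryInput_le A
  have := hT.const_nonneg
  have : 0 < 1 - ρ := sub_pos.2 hT.rate_lt_one
  refine ⟨C * (M + M) / (1 - ρ), ρ, by positivity, hT.rate_pos.le, hT.rate_lt_one,
    fun t k x v w hvw => ?_⟩
  refine (norm_le_pi_norm (latentState B A Γ t (x, v) - latentState B A Γ t (x, w)) 0).trans ?_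
  refine hT.norm_causalSum_sub_le (fun s => ?_) (k - p) fun s hs => ?_
  · rw [← Pi.single_sub, Pi.norm_single, input, input, add_sub_add_right_eq_sub]
    exact norm_sub_le_of_le (hM v s) (hM w s)
  · have hss : Ico (s - p) s ⊆ Ico (t - k) t := by
      obtain ⟨hs₁, hs₂⟩ := hs
      exact Ico_subset_Ico (by omega) hs₂
    simp only [input, categoryInput_congr (hvw.mono hss)]

lemma latentSummable_of_eventually_norm_le (hB : ∀ z : ℂ, charFun B z = 0 → 1 < ‖z‖) :
    ∃ τ : ℝ, 1 < τ ∧ ∀ x : ℤ → Fin d → ℝ, (∀ t, ∀ᶠ k : ℕ in atTop, ‖x (t - k)‖ ≤ τ ^ k) →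
      ∀ v, LatentSummable B A Γ (x, v) := by
  obtain ⟨C, ρ, hT⟩ := exists_geometricDecay_companion hB
  obtain ⟨M, hM0, hM⟩ := exists_norm_categoryInput_le A
  obtain ⟨τ, hτ1, hτ⟩ := exists_between ((one_lt_inv₀ hT.rate_pos).2 hT.rate_lt_one)
  refine ⟨τ, hτ1, fun x hx v t => ?_⟩
  let G : (Fin d → ℝ) →L[ℝ] Fin n → ℝ := LinearMap.toContinuousLinearMap Γ.mulVecLin
  refine hT.summable_of_le (w := fun s => Pi.single 0 (input A Γ s (x, v))) (M := M + ‖G‖)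
    (τ := τ) (by positivity) ((lt_mul_inv_iff₀ hT.rate_pos).1 (by rwa [one_mul])) ?_
  filter_upwards [hx t] with k hk
  rw [Pi.norm_single, add_mul]
  refine norm_add_le_of_le ((hM v _).trans ?_) (G.le_opNorm_of_le hk)
  exact le_mul_of_one_le_right hM0 (one_le_pow₀ hτ1.le)

theorem ae_latentSummable (hB : ∀ z : ℂ, charFun B z = 0 → 1 < ‖z‖)
    {μ : Measure (ℤ → Fin d → ℝ)} [IsProbabilityMeasure μ] (hμ : MeasurePreserving shift μ μ)
    {s₀ : ℤ} (hlog : Integrable (fun x : ℤ → Fin d → ℝ => Real.posLog ‖x s₀‖) μ) :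
    ∀ᵐ x ∂μ, ∀ v, LatentSummable B A Γ (x, v) := by
  obtain ⟨τ, hτ, hsum⟩ := latentSummable_of_eventually_norm_le (A := A) (Γ := Γ) hB
  filter_upwards [ae_all_iff.2 fun t => ae_eventually_norm_le_pow hμ hlog hτ t] with x hx
  exact hsum x hx

variable (B A Γ) in
/-- The conditional probability of the category `y` at time `t`, as a function of the trajectories
of the covariates and of the categories. -/
def logitKernel (t : ℤ) (y : Fin (n + 1)) (z : (ℤ → Fin d → ℝ) × (ℤ → Fin (n + 1))) : ℝ≥0∞ :=
  ENNReal.ofReal (catProb (latent B A Γ t z) y)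

lemma logitKernel_translate (t c : ℤ) (y : Fin (n + 1))
    (z : (ℤ → Fin d → ℝ) × (ℤ → Fin (n + 1))) :
    logitKernel B A Γ t y (fun s => z.1 (s + c), fun s => z.2 (s + c)) =
      logitKernel B A Γ (t + c) y z := by
  rw [logitKernel, latent_translate, logitKernel]

variable (A Γ) in
theorem exists_isTransition_logitKernel (hB : ∀ z : ℂ, charFun B z = 0 → 1 < ‖z‖) :
    ∃ r : ℕ → ℝ, IsTransition (logitKernel B A Γ) r := by
  obtain ⟨K, ρ, hK, hρ0, hρ1, hlatent⟩ := exists_norm_latent_sub_le A Γ hB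
  refine ⟨fun k => 2 * (K * ρ ^ (k - p)), fun t y => ?_, fun t z => ?_, fun k => by positivity,
    ?_, fun t y k x v w hvw => ?_⟩
  · have hlat : Measurable[window (Iio t)] (latent B A Γ t) :=
      measurable_latent_comp (m := window (Iio t))
        (fun s _ => (measurable_pi_apply s).comp (measurable_fst_window _))
        fun s hs => measurable_eval_window hs
    exact ((measurable_catProb y).comp hlat).ennreal_ofReal
  · simp only [logitKernel]
    rw [← ENNReal.ofReal_sum_of_nonneg fun y _ => (catProb_pos _ y).le, sum_catProb,
      ENNReal.ofReal_one]
  · rw [← summable_nat_add_iff p]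
    simpa only [Nat.add_sub_cancel] using
      ((summable_geometric_of_lt_one hρ0 hρ1).mul_left K).mul_left 2
  · rw [logitKernel, logitKernel, ← ENNReal.ofReal_mul (Real.exp_nonneg _)]
    exact ENNReal.ofReal_le_ofReal (catProb_le_exp_mul (hlatent t k x v w hvw) y)

end Latent

section Recurrence

lemma measurable_path {Ω S : Type*} [MeasurableSpace Ω] [MeasurableSpace S] {Z : ℤ → Ω → S}
    (hZ : ∀ t, Measurable (Z t)) : Measurable (path Z) :=
  measurable_pi_lambda _ hZ

-- The law of `ψ ∘ θ^[m]` does not depend on `m`, whereas `ψ ∘ θ^[m]` tends to zero.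
lemma ae_eq_zero_of_comp_ae_eq {α V : Type*} [MeasurableSpace α] {μ : Measure α} [IsFiniteMeasure μ]
    [NormedAddCommGroup V] {θ : α → α} (hθ : MeasurePreserving θ μ μ) {ψ : α → V}
    (hψ : StronglyMeasurable ψ) {T : V → V} (hT : ∀ v, Tendsto (fun m => T^[m] v) atTop (𝓝 0))
    (hψθ : ψ ∘ θ =ᵐ[μ] T ∘ ψ) : ψ =ᵐ[μ] 0 := by
  have hiter (m : ℕ) : ψ ∘ θ^[m] =ᵐ[μ] T^[m] ∘ ψ := by
    induction m with
    | zero => rfl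
    | succ m ih =>
      filter_upwards [hθ.quasiMeasurePreserving.ae ih, hψθ] with z hz hz'
      simp only [Function.comp_apply, Function.iterate_succ] at hz hz' ⊢
      rw [hz, hz']
  have hzero : TendstoInMeasure μ (fun m => ψ ∘ θ^[m]) atTop 0 := by
    refine tendstoInMeasure_of_tendsto_ae
      (fun m => (hψ.comp_measurable (hθ.iterate m).measurable).aestronglyMeasurable) ?_
    filter_upwards [ae_all_iff.2 hiter] with z hz
    simp only [hz]
    exact hT (ψ z)
  have hconst : TendstoInMeasure μ (fun _ : ℕ => ψ) atTop 0 := fun ε hε => by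
    refine (hzero ε hε).congr fun m => (hθ.iterate m).measure_preimage ?_
    exact (measurableSet_le measurable_const
      (hψ.edist stronglyMeasurable_const).measurable).nullMeasurableSet
  exact tendstoInMeasure_ae_unique
    (tendstoInMeasure_of_tendsto_ae (fun _ => hψ.aestronglyMeasurable)
      (ae_of_all _ fun _ => tendsto_const_nhds)) hconst

variable {n q : ℕ} {B : Fin q → Matrix (Fin n) (Fin n) ℝ}
  {Ω : Type*} [MeasurableSpace Ω] {P : Measure Ω} [IsFiniteMeasure P]

theorem IsStationary.ae_eq_zero_of_recursion (hB : ∀ z : ℂ, charFun B z = 0 → 1 < ‖z‖)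
    {D : ℤ → Ω → Fin n → ℝ} (hDm : ∀ t, Measurable (D t)) (hD : IsStationary P D)
    (hrec : ∀ t, ∀ᵐ ω ∂P, D t ω = ∑ j : Fin q, (B j).mulVec (D (t - ((j : ℤ) + 1)) ω)) (t : ℤ) :
    D t =ᵐ[P] 0 := by
  obtain ⟨C, ρ, hT⟩ := exists_geometricDecay_companion hB
  have hpath := measurable_path hDm
  have hmulVec (j : Fin q) : Continuous fun u : Fin n → ℝ => (B j).mulVec u := by fun_prop
  let ψ : (ℤ → Fin n → ℝ) → Fin (q + 1) → Fin n → ℝ := fun v j => v (t - j)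
  have hψ : Measurable ψ := by fun_prop
  have hrec' : ∀ᵐ v ∂P.map (path D),
      v (t + 1) = ∑ j : Fin q, (B j).mulVec (v (t + 1 - ((j : ℤ) + 1))) := by
    refine (ae_map_iff hpath.aemeasurable (measurableSet_eq_fun (by fun_prop) ?_)).2 (hrec (t + 1))
    exact Finset.measurable_sum _ fun j _ => (hmulVec j).measurable.comp (by fun_prop)
  have hψshift : ψ ∘ shift =ᵐ[P.map (path D)] companion B ∘ ψ := by
    filter_upwards [hrec'] with v hv
    funext j
    simp only [Function.comp_apply, ψ, shift]
    cases j using Fin.cases with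
    | zero => simpa [companion_apply_zero, add_sub_add_right_eq_sub] using hv
    | succ j => simp [companion_apply_succ, sub_add_eq_add_sub]
  have hψ0 : ψ =ᵐ[P.map (path D)] 0 :=
    ae_eq_zero_of_comp_ae_eq hD hψ.stronglyMeasurable
      (fun v => by simpa only [FunLike.coe_pow_eq_iterate] using hT.tendsto_pow_apply v) hψshift
  filter_upwards [ae_of_ae_map hpath.aemeasurable hψ0] with ω hω
  simpa [ψ, path] using congrFun hω 0

end Recurrence

section CondExp

variable {Ω : Type*} {m m0 : MeasurableSpace Ω} {P : Measure Ω} [IsFiniteMeasure P]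

lemma condProb_ae_eq_iff_forall_setLIntegral (hm : m ≤ m0) {s : Set Ω} (hs : MeasurableSet s)
    {f : Ω → ℝ} (hfm : Measurable[m] f) (hfi : Integrable f P) (hf0 : 0 ≤ f) :
    P⟦s | m⟧ =ᵐ[P] f ↔
      ∀ A, MeasurableSet[m] A → P (A ∩ s) = ∫⁻ ω in A, ENNReal.ofReal (f ω) ∂P := by
  have hind : Integrable (s.indicator fun _ => (1 : ℝ)) P := (integrable_const 1).indicator hs
  have hindA (A : Set Ω) : ∫ ω in A, s.indicator (fun _ => (1 : ℝ)) ω ∂P = P.real (A ∩ s) := by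
    rw [setIntegral_indicator hs, setIntegral_one_eq_measureReal]
  have hfA (A : Set Ω) : ∫⁻ ω in A, ENNReal.ofReal (f ω) ∂P = ENNReal.ofReal (∫ ω in A, f ω ∂P) :=
    (ofReal_integral_eq_lintegral_ofReal hfi.integrableOn (ae_of_all _ hf0)).symm
  constructor
  · intro h A hA
    rw [hfA, ← setIntegral_congr_ae (hm A hA) (h.mono fun ω hω _ => hω),
      setIntegral_condExp hm hind hA, hindA, ofReal_measureReal]
  · intro h
    refine (ae_eq_condExp_of_forall_setIntegral_eq hm hind (fun _ _ _ => hfi.integrableOn)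
      (fun A hA _ => ?_) hfm.stronglyMeasurable.aestronglyMeasurable).symm
    rw [hindA, Measure.real, h A hA, hfA, ENNReal.toReal_ofReal (integral_nonneg hf0)]

lemma condExp_comp_measurePreserving {Ω' : Type*} {m' m0' : MeasurableSpace Ω'} (hm : m' ≤ m0')
    {Q : Measure Ω'} [IsFiniteMeasure Q] {f : Ω → Ω'} (hf : MeasurePreserving f P Q) {u : Ω' → ℝ}
    (hu : Integrable u Q) : P[u ∘ f | m'.comap f] =ᵐ[P] Q[u | m'] ∘ f := by
  have hcomap : m'.comap f ≤ m0 := (MeasurableSpace.comap_mono hm).trans hf.measurable.comap_le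
  have hcond : StronglyMeasurable[m'] (Q[u | m']) := stronglyMeasurable_condExp
  have hintegral {w : Ω' → ℝ} (hw : Integrable w Q) {A : Set Ω'} (hA : MeasurableSet A) :
      ∫ ω in f ⁻¹' A, w (f ω) ∂P = ∫ ω in A, w ω ∂Q := by
    rw [← hf.map_eq] at hw ⊢
    exact (setIntegral_map hA hw.aestronglyMeasurable hf.aemeasurable).symm
  refine (ae_eq_condExp_of_forall_setIntegral_eq hcomap (hf.integrable_comp_of_integrable hu)
    (fun _ _ _ => (hf.integrable_comp_of_integrable integrable_condExp).integrableOn) ?_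
    (hcond.comp_measurable (comap_measurable f)).aestronglyMeasurable).symm
  rintro _ ⟨A, hA, rfl⟩ -
  exact (hintegral integrable_condExp (hm A hA)).trans
    ((setIntegral_condExp hm hu hA).trans (hintegral hu (hm A hA)).symm)

lemma condProb_comp_measurePreserving {Ω' : Type*} {m' m0' : MeasurableSpace Ω'} (hm : m' ≤ m0')
    {Q : Measure Ω'} [IsFiniteMeasure Q] {f : Ω → Ω'} (hf : MeasurePreserving f P Q) {s : Set Ω'}
    (hs : MeasurableSet s) : P⟦f ⁻¹' s | m'.comap f⟧ =ᵐ[P] Q⟦s | m'⟧ ∘ f :=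
  condExp_comp_measurePreserving hm hf ((integrable_const (1 : ℝ)).indicator hs)

lemma condProb_comap_ae_eq_iff {Ω' : Type*} {m' m0' : MeasurableSpace Ω'} (hm : m' ≤ m0')
    {Φ : Ω → Ω'} (hΦ : Measurable Φ) {s : Set Ω'} (hs : MeasurableSet s) {f : Ω' → ℝ}
    (hfm : Measurable[m'] f) (hfi : Integrable f (P.map Φ)) (hf0 : 0 ≤ f) :
    P⟦Φ ⁻¹' s | m'.comap Φ⟧ =ᵐ[P] f ∘ Φ ↔ ∀ A, MeasurableSet[m'] A →
      P.map Φ (A ∩ s) = ∫⁻ ω in A, ENNReal.ofReal (f ω) ∂P.map Φ := by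
  have hcomp := condProb_comp_measurePreserving (P := P) hm ⟨hΦ, rfl⟩ hs
  rw [← condProb_ae_eq_iff_forall_setLIntegral hm hs hfm hfi hf0]
  have hset : MeasurableSet {z | ((P.map Φ)⟦s | m'⟧) z = f z} :=
    measurableSet_eq_fun (stronglyMeasurable_condExp.mono hm).measurable (hfm.mono hm le_rfl)
  have hae : P.map Φ⟦s | m'⟧ =ᵐ[P.map Φ] f ↔ (P.map Φ⟦s | m'⟧) ∘ Φ =ᵐ[P] f ∘ Φ :=
    ae_map_iff hΦ.aemeasurable hset
  exact ⟨fun h => hae.2 (hcomp.symm.trans h), fun h => hcomp.trans (hae.1 h)⟩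

end CondExp

section JointPath

variable {Ω S E : Type*}

/-- The joint trajectory of the covariates and of the categories. -/
def jointPath (X : ℤ → Ω → S) (Y : ℤ → Ω → E) (ω : Ω) : (ℤ → S) × (ℤ → E) :=
  (path X ω, path Y ω)

variable [MeasurableSpace S] [MeasurableSpace E]

/-- The σ-algebra generated by the categories with times in `I` and the covariates with times
in `J`, on the space of joint trajectories. -/
abbrev coordGen (I J : Set ℤ) : MeasurableSpace ((ℤ → S) × (ℤ → E)) :=
  sigmaGen (fun s z => z.2 s) I ⊔ sigmaGen (fun s z => z.1 s) J

lemma sigmaGen_mono {Z : ℤ → Ω → S} {I J : Set ℤ} (h : I ⊆ J) : sigmaGen Z I ≤ sigmaGen Z J :=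
  biSup_mono h

lemma measurable_sigmaGen (Z : ℤ → Ω → S) {I : Set ℤ} {s : ℤ} (hs : s ∈ I) :
    Measurable[sigmaGen Z I] (Z s) :=
  (comap_measurable (Z s)).mono (le_biSup (fun s => MeasurableSpace.comap (Z s) _) hs) le_rfl

lemma sigmaGen_translate (Z : ℤ → Ω → S) (I : Set ℤ) (c : ℤ) :
    sigmaGen (fun s => Z (s + c)) I = sigmaGen Z ((· + c) '' I) := by
  rw [sigmaGen, sigmaGen, iSup_image]

lemma measurable_fst_coordGen (I : Set ℤ) {J : Set ℤ} {s : ℤ} (hs : s ∈ J) :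
    Measurable[coordGen I J] fun z : (ℤ → S) × (ℤ → E) => z.1 s :=
  (measurable_sigmaGen _ hs).mono le_sup_right le_rfl

lemma measurable_snd_coordGen {I : Set ℤ} (J : Set ℤ) {s : ℤ} (hs : s ∈ I) :
    Measurable[coordGen I J] fun z : (ℤ → S) × (ℤ → E) => z.2 s :=
  (measurable_sigmaGen _ hs).mono le_sup_left le_rfl

lemma coordGen_univ (I : Set ℤ) : coordGen (S := S) (E := E) I univ = window I := by
  refine le_antisymm (sup_le (iSup₂_le fun s hs => ?_) (iSup₂_le fun s _ => ?_))
    (window_le_of_measurable ?_ fun s hs => ?_)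
  · exact (measurable_eval_window hs).comap_le
  · exact ((measurable_pi_apply s).comp (measurable_fst_window I)).comap_le
  · exact (@measurable_pi_iff _ _ _ (coordGen I univ) _ _).2 fun s =>
      measurable_fst_coordGen I (mem_univ s)
  · exact measurable_snd_coordGen univ hs

lemma coordGen_le_window (I J : Set ℤ) : coordGen (S := S) (E := E) I J ≤ window I :=
  (sup_le_sup_left (sigmaGen_mono (subset_univ J)) _).trans (coordGen_univ I).le

lemma comap_jointPath_coordGen (X : ℤ → Ω → S) (Y : ℤ → Ω → E) (I J : Set ℤ) :
    (coordGen I J).comap (jointPath X Y) = sigmaGen Y I ⊔ sigmaGen X J := by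
  simp only [sigmaGen, MeasurableSpace.comap_sup, MeasurableSpace.comap_iSup,
    MeasurableSpace.comap_comp]
  rfl

variable [MeasurableSpace Ω] {P : Measure Ω} {X : ℤ → Ω → S} {Y : ℤ → Ω → E}

lemma measurable_jointPath (hX : ∀ t, Measurable (X t)) (hY : ∀ t, Measurable (Y t)) :
    Measurable (jointPath X Y) :=
  measurable_of_coordinates (measurable_path hX) hY

lemma map_fst_map_jointPath (hX : ∀ t, Measurable (X t)) (hY : ∀ t, Measurable (Y t)) :
    (P.map (jointPath X Y)).map Prod.fst = P.map (path X) :=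
  Measure.map_map measurable_fst (measurable_jointPath hX hY)

lemma measurePreserving_path_jointPath (hX : ∀ t, Measurable (X t)) (hY : ∀ t, Measurable (Y t)) :
    MeasurePreserving (fun z : (ℤ → S) × (ℤ → E) => fun t => (z.2 t, z.1 t))
      (P.map (jointPath X Y)) (P.map (path fun t ω => (Y t ω, X t ω))) :=
  ⟨by fun_prop, Measure.map_map (by fun_prop) (measurable_jointPath hX hY)⟩

lemma measurePreserving_jointPath_path (hX : ∀ t, Measurable (X t)) (hY : ∀ t, Measurable (Y t)) :
    MeasurePreserving (fun z : ℤ → E × S => ((fun t => (z t).2, fun t => (z t).1) :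
      (ℤ → S) × (ℤ → E))) (P.map (path fun t ω => (Y t ω, X t ω))) (P.map (jointPath X Y)) :=
  ⟨by fun_prop, Measure.map_map (by fun_prop)
    (measurable_path fun t => (hY t).prodMk (hX t))⟩

lemma IsStationary.measurePreserving_skewShift (hX : ∀ t, Measurable (X t))
    (hY : ∀ t, Measurable (Y t)) (hst : IsStationary P fun t ω => (Y t ω, X t ω)) :
    MeasurePreserving (skewShift (shiftEquiv S)) (P.map (jointPath X Y))
      (P.map (jointPath X Y)) :=
  .of_semiconj (measurePreserving_jointPath_path hX hY) hst (fun _ => rfl)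
    (skewShift (shiftEquiv S)).measurable

lemma IsStationary.measurePreserving_jointPath_translate (hX : ∀ t, Measurable (X t))
    (hY : ∀ t, Measurable (Y t)) (hst : IsStationary P fun t ω => (Y t ω, X t ω)) (c : ℤ) :
    MeasurePreserving (jointPath (fun t => X (t + c)) fun t => Y (t + c)) P
      (P.map (jointPath X Y)) :=
  ((measurePreserving_jointPath_path hX hY).comp (measurePreserving_translate hst c)).comp
    ⟨measurable_path fun t => (hY t).prodMk (hX t), rfl⟩

lemma isStationaryErgodic_of_ergodic_skewShift (hX : ∀ t, Measurable (X t))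
    (hY : ∀ t, Measurable (Y t))
    (h : Ergodic (skewShift (shiftEquiv S)) (P.map (jointPath X Y))) :
    IsStationaryErgodic P fun t ω => (Y t ω, X t ω) :=
  (measurePreserving_path_jointPath hX hY).ergodic_of_ergodic_semiconj h
    measurable_shift (fun _ => rfl)

lemma isStationary_of_factor {α S' : Type*} [MeasurableSpace α] [MeasurableSpace S']
    {Q : Measure α} {θ : α → α} (hθ : MeasurePreserving θ Q Q) {Φ : Ω → α}
    (hΦ : MeasurePreserving Φ P Q) {f : ℤ → α → S'} (hf : ∀ t, Measurable (f t))
    (hfθ : ∀ t z, f t (θ z) = f (t + 1) z) {D : ℤ → Ω → S'} (hD : ∀ t, D t =ᵐ[P] f t ∘ Φ) :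
    IsStationary P D := by
  have hpath := measurable_path hf
  have hlaw : P.map (path D) = Q.map (path f) := by
    rw [← hΦ.map_eq, Measure.map_map hpath hΦ.measurable]
    refine Measure.map_congr ?_
    filter_upwards [ae_all_iff.2 hD] with ω hω
    exact funext hω
  rw [IsStationary, hlaw]
  exact .of_semiconj ⟨hpath, rfl⟩ hθ (fun z => funext fun t => hfθ t z) measurable_shift

end JointPath

section Solution

variable {n d p q : ℕ} {B : Fin q → Matrix (Fin n) (Fin n) ℝ}
  {A : Fin p → Matrix (Fin n) (Fin n) ℝ} {Γ : Matrix (Fin n) (Fin d) ℝ}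
  {Ω : Type*} [MeasurableSpace Ω] {P : Measure Ω}
  {X : ℤ → Ω → Fin d → ℝ} {Y : ℤ → Ω → Fin (n + 1)} {lam : ℤ → Ω → Fin n → ℝ}

lemma ae_latentSummable_jointPath
    (hX : ∀ t, Measurable (X t))
    (h : ∀ᵐ x ∂P.map (path X), ∀ v, LatentSummable B A Γ (x, v)) :
    ∀ᵐ ω ∂P, LatentSummable B A Γ (jointPath X Y ω) :=
  (ae_of_ae_map (measurable_path hX).aemeasurable h).mono fun _ hω => hω _

lemma ae_latentSummable_path [IsProbabilityMeasure P] (hB : ∀ z : ℂ, charFun B z = 0 → 1 < ‖z‖)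
    (hX : ∀ t, Measurable (X t)) (hst : IsStationary P X) {s₀ : ℤ}
    (hlog : Integrable (fun ω => Real.posLog ‖X s₀ ω‖) P) :
    ∀ᵐ x ∂P.map (path X), ∀ v, LatentSummable B A Γ (x, v) := by
  have hpath := measurable_path hX
  have := Measure.isProbabilityMeasure_map (μ := P) hpath.aemeasurable
  have hposLog : Measurable fun x : ℤ → Fin d → ℝ => Real.posLog ‖x s₀‖ := by
    unfold Real.posLog
    fun_prop
  exact ae_latentSummable hB hst <|
    (integrable_map_measure hposLog.aestronglyMeasurable hpath.aemeasurable).2 hlog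

/-- The latent variable at time `t` is read off the conditional probabilities, hence is the same
function of the trajectory translated by `t` for all `t`. -/
lemma IsSolution.exists_lam_eq [IsFiniteMeasure P] (hsol : IsSolution B A Γ P X Y lam)
    (hst : IsStationary P fun t ω => (Y t ω, X t ω)) :
    ∃ Λ : (ℤ → Fin d → ℝ) × (ℤ → Fin (n + 1)) → Fin n → ℝ, Measurable Λ ∧
      ∀ t, lam t =ᵐ[P] Λ ∘ jointPath (fun s => X (s + t)) fun s => Y (s + t) := by
  have hle := (coordGen_le_window (S := Fin d → ℝ) (E := Fin (n + 1)) (Iio 0) (Iic 0)).trans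
    (window_le _)
  let category (y : Fin (n + 1)) : Set ((ℤ → Fin d → ℝ) × (ℤ → Fin (n + 1))) := {z | z.2 0 = y}
  let η (z : (ℤ → Fin d → ℝ) × (ℤ → Fin (n + 1))) (i : Fin n) : ℝ :=
    ((P.map (jointPath X Y))⟦category i.succ | coordGen (Iio 0) (Iic 0)⟧) z
  have hη : Measurable η :=
    measurable_pi_lambda _ fun i => (stronglyMeasurable_condExp.mono hle).measurable
  refine ⟨fun z => logitInv (η z), measurable_logitInv.comp hη, fun t => ?_⟩
  have hpast : (coordGen (Iio 0) (Iic 0)).comap (jointPath (fun s => X (s + t)) fun s => Y (s + t))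
      = sigmaGen Y (Iio t) ⊔ sigmaGen X (Iic t) := by
    rw [comap_jointPath_coordGen, sigmaGen_translate, sigmaGen_translate, image_add_const_Iio,
      image_add_const_Iic, zero_add]
  have hcond (i : Fin n) : ∀ᵐ ω ∂P,
      logit (lam t ω) i = η (jointPath (fun s => X (s + t)) (fun s => Y (s + t)) ω) i := by
    have h := condProb_comp_measurePreserving hle
      (hst.measurePreserving_jointPath_translate hsol.measurable_X hsol.measurable_Y t)
      (measurableSet_category 0 i.succ)
    have hcategory : jointPath (fun s => X (s + t)) (fun s => Y (s + t)) ⁻¹' category i.succ =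
        Y t ⁻¹' {i.succ} := by
      ext ω
      simp [category, jointPath, path]
    rw [hcategory, hpast] at h
    exact (hsol.condProb t i).symm.trans h
  filter_upwards [ae_all_iff.2 hcond] with ω hω
  rw [← logitInv_logit (lam t ω)]
  exact congrArg logitInv (funext hω)

/-- The difference of `lam` and `latent` is a stationary solution of the homogeneous recursion. -/
theorem IsSolution.lam_eq_latent [IsFiniteMeasure P]
    (hB : ∀ z : ℂ, charFun B z = 0 → 1 < ‖z‖) (hsol : IsSolution B A Γ P X Y lam)
    (hst : IsStationary P fun t ω => (Y t ω, X t ω))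
    (hsum : ∀ᵐ ω ∂P, LatentSummable B A Γ (jointPath X Y ω)) (t : ℤ) :
    lam t =ᵐ[P] latent B A Γ t ∘ jointPath X Y := by
  obtain ⟨Λ, hΛ, hlam⟩ := hsol.exists_lam_eq hst
  have hjoint := measurable_jointPath hsol.measurable_X hsol.measurable_Y
  let D (t : ℤ) (ω : Ω) : Fin n → ℝ := lam t ω - latent B A Γ t (jointPath X Y ω)
  have hDm (t : ℤ) : Measurable (D t) :=
    (hsol.measurable_lam t).sub ((measurable_latent t).comp hjoint)
  have hDst : IsStationary P D := by
    refine isStationary_of_factor (hst.measurePreserving_skewShift hsol.measurable_X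
      hsol.measurable_Y) ⟨hjoint, rfl⟩ (f := fun t z =>
        Λ (fun s => z.1 (s + t), fun s => z.2 (s + t)) - latent B A Γ t z) (fun t => ?_)
      (fun t z => ?_) fun t => ?_
    · exact (hΛ.comp (by fun_prop)).sub (measurable_latent t)
    · refine congrArg₂ _ (congrArg Λ ?_) (latent_translate t 1 z)
      simp only [← add_assoc]
      rfl
    · filter_upwards [hlam t] with ω hω
      simp only [D, hω]
      rfl
  have hDrec (t : ℤ) : ∀ᵐ ω ∂P, D t ω = ∑ j : Fin q, (B j).mulVec (D (t - ((j : ℤ) + 1)) ω) := by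
    filter_upwards [hsum, hsol.recursion t] with ω hω hlamω
    simp only [D, Matrix.mulVec_sub, Finset.sum_sub_distrib]
    rw [hlamω, hω.latent_recursion t, add_assoc]
    exact add_sub_add_right_eq_sub _ _ _
  filter_upwards [hDst.ae_eq_zero_of_recursion hB hDm hDrec t] with ω hω
  exact sub_eq_zero.1 hω

lemma measurable_latent_coordGen {t : ℤ} {J : Set ℤ} (hJ : Iic t ⊆ J) :
    Measurable[coordGen (Iio t) J] (latent B A Γ t) :=
  measurable_latent_comp (m := coordGen (Iio t) J) (f := id)
    (fun _ hs => measurable_fst_coordGen _ (hJ hs)) fun _ hs => measurable_snd_coordGen _ hs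

lemma condProb_category_iff [IsFiniteMeasure P] (hX : ∀ t, Measurable (X t))
    (hY : ∀ t, Measurable (Y t)) {t : ℤ} {J : Set ℤ} (hJ : Iic t ⊆ J) (y : Fin (n + 1)) :
    P⟦Y t ⁻¹' {y} | sigmaGen Y (Iio t) ⊔ sigmaGen X J⟧ =ᵐ[P]
        (fun ω => catProb (latent B A Γ t (jointPath X Y ω)) y) ↔
      ∀ C, MeasurableSet[coordGen (Iio t) J] C → P.map (jointPath X Y) (C ∩ {z | z.2 t = y}) =
        ∫⁻ z in C, logitKernel B A Γ t y z ∂P.map (jointPath X Y) := by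
  have hjoint := measurable_jointPath hX hY
  have hle := (coordGen_le_window (S := Fin d → ℝ) (E := Fin (n + 1)) (Iio t) J).trans (window_le _)
  have hlat := (measurable_catProb y).comp <|
    measurable_latent_coordGen (B := B) (A := A) (Γ := Γ) hJ
  have hlat' := hlat.mono hle le_rfl
  have hint : Integrable (fun z => catProb (latent B A Γ t z) y) (P.map (jointPath X Y)) :=
    .of_bound hlat'.aestronglyMeasurable 1 (ae_of_all _ fun z => norm_catProb_le_one _ y)
  rw [← comap_jointPath_coordGen]
  exact condProb_comap_ae_eq_iff hle hjoint (measurableSet_category t y) hlat hint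
    fun z => (catProb_pos _ y).le

lemma IsCompatible.of_succ {𝓧 : Type*} [MeasurableSpace 𝓧]
    {g : ℤ → Fin (n + 1) → 𝓧 × (ℤ → Fin (n + 1)) → ℝ≥0∞} {r : ℕ → ℝ} (hg : IsTransition g r)
    {Q : Measure (𝓧 × (ℤ → Fin (n + 1)))} [IsFiniteMeasure Q]
    (h : ∀ (t : ℤ) (i : Fin n) (C : Set (𝓧 × (ℤ → Fin (n + 1)))), MeasurableSet[window (Iio t)] C →
      Q (C ∩ {z | z.2 t = i.succ}) = ∫⁻ z in C, g t i.succ z ∂Q) : IsCompatible g Q := by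
  intro t y C hC
  refine Fin.cases ?_ (fun i => h t i C hC) y
  have hsum : ∑ y, Q (C ∩ {z | z.2 t = y}) = ∑ y, ∫⁻ z in C, g t y z ∂Q :=
    (sum_measure_inter_category C).trans (hg.sum_setLIntegral t C).symm
  simp only [Fin.sum_univ_succ, ← h t _ C hC] at hsum
  exact (ENNReal.add_left_inj (ENNReal.sum_ne_top.2 fun _ _ => measure_ne_top _ _)).1 hsum

lemma IsSolution.isCompatible [IsFiniteMeasure P] (hB : ∀ z : ℂ, charFun B z = 0 → 1 < ‖z‖)
    (hsol : IsSolution B A Γ P X Y lam)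
    (hlam : ∀ t, lam t =ᵐ[P] latent B A Γ t ∘ jointPath X Y) :
    IsCompatible (logitKernel B A Γ) (P.map (jointPath X Y)) := by
  obtain ⟨r, hr⟩ := exists_isTransition_logitKernel A Γ hB
  refine .of_succ hr fun t i C hC => ?_
  have hcond : P⟦Y t ⁻¹' {i.succ} | sigmaGen Y (Iio t) ⊔ sigmaGen X univ⟧ =ᵐ[P]
      fun ω => catProb (latent B A Γ t (jointPath X Y ω)) i.succ := by
    refine (hsol.exogenous t i.succ).symm.trans ((hsol.condProb t i).trans ?_)
    filter_upwards [hlam t] with ω hω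
    rw [catProb_succ, hω, Function.comp_apply]
  exact (condProb_category_iff hsol.measurable_X hsol.measurable_Y (subset_univ _) _).1 hcond C
    (by rwa [coordGen_univ])

theorem isSolution_of_isCompatible [IsFiniteMeasure P] (hX : ∀ t, Measurable (X t))
    (hY : ∀ t, Measurable (Y t)) (hsum : ∀ᵐ x ∂P.map (path X), ∀ v, LatentSummable B A Γ (x, v))
    (hcompat : IsCompatible (logitKernel B A Γ) (P.map (jointPath X Y))) :
    IsSolution B A Γ P X Y fun t ω => latent B A Γ t (jointPath X Y ω) := by
  have hcond {t : ℤ} {J : Set ℤ} (hJ : Iic t ⊆ J) (y : Fin (n + 1)) :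
      P⟦Y t ⁻¹' {y} | sigmaGen Y (Iio t) ⊔ sigmaGen X J⟧ =ᵐ[P]
        fun ω => catProb (latent B A Γ t (jointPath X Y ω)) y :=
    (condProb_category_iff hX hY hJ y).2 fun C hC => hcompat t y C (coordGen_le_window _ _ _ hC)
  refine ⟨hX, hY, fun t => (measurable_latent t).comp (measurable_jointPath hX hY), fun t => ?_,
    fun t i => ?_, fun t y => ?_⟩
  · filter_upwards [ae_latentSummable_jointPath hX hsum] with ω hω
    rw [hω.latent_recursion t, input, ← add_assoc]
    rfl
  · simpa only [catProb_succ] using hcond subset_rfl i.succ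
  · exact (hcond subset_rfl y).trans (hcond (subset_univ _) y).symm

/-- The value at time `t` of the process made of the categories, of the covariates and of the latent
variable, as a function of the joint trajectory of the covariates and of the categories. -/
def withLatent (B : Fin q → Matrix (Fin n) (Fin n) ℝ) (A : Fin p → Matrix (Fin n) (Fin n) ℝ)
    (Γ : Matrix (Fin n) (Fin d) ℝ) (t : ℤ) (z : (ℤ → Fin d → ℝ) × (ℤ → Fin (n + 1))) :
    Fin (n + 1) × (Fin d → ℝ) × (Fin n → ℝ) :=
  (z.2 t, z.1 t, latent B A Γ t z)

lemma measurable_withLatent (t : ℤ) : Measurable (withLatent B A Γ t) :=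
  Measurable.prodMk (by fun_prop) (Measurable.prodMk (by fun_prop) (measurable_latent t))

lemma map_path_eq_map_withLatent (hX : ∀ t, Measurable (X t)) (hY : ∀ t, Measurable (Y t))
    (hlam : ∀ t, lam t =ᵐ[P] latent B A Γ t ∘ jointPath X Y) :
    P.map (path fun t ω => (Y t ω, X t ω, lam t ω)) =
      (P.map (jointPath X Y)).map (path (withLatent B A Γ)) := by
  rw [Measure.map_map (measurable_path measurable_withLatent) (measurable_jointPath hX hY)]
  refine Measure.map_congr ?_
  filter_upwards [ae_all_iff.2 hlam] with ω hω
  exact funext fun t => congrArg (fun l => (Y t ω, X t ω, l)) (hω t)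

lemma isStationary_of_ae_eq_latent (hX : ∀ t, Measurable (X t)) (hY : ∀ t, Measurable (Y t))
    (hlam : ∀ t, lam t =ᵐ[P] latent B A Γ t ∘ jointPath X Y)
    (hst : IsStationary P fun t ω => (Y t ω, X t ω)) :
    IsStationary P fun t ω => (Y t ω, X t ω, lam t ω) := by
  refine isStationary_of_factor (hst.measurePreserving_skewShift hX hY)
    ⟨measurable_jointPath hX hY, rfl⟩ (f := withLatent B A Γ) measurable_withLatent
    (fun t z => ?_) fun t => ?_
  · exact congrArg (fun l => (z.2 (t + 1), z.1 (t + 1), l)) (latent_translate t 1 z)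
  · exact (hlam t).mono fun ω hω => congrArg (fun l => (Y t ω, X t ω, l)) hω

theorem IsSolution.map_path_eq [IsProbabilityMeasure P]
    (hB : ∀ z : ℂ, charFun B z = 0 → 1 < ‖z‖) (hsol : IsSolution B A Γ P X Y lam)
    (hst : IsStationary P fun t ω => (Y t ω, X t ω))
    (hsum : ∀ᵐ x ∂P.map (path X), ∀ v, LatentSummable B A Γ (x, v))
    {Q : Measure ((ℤ → Fin d → ℝ) × (ℤ → Fin (n + 1)))} [IsFiniteMeasure Q]
    (hQ : IsCompatible (logitKernel B A Γ) Q) (hfst : Q.map Prod.fst = P.map (path X)) :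
    P.map (path fun t ω => (Y t ω, X t ω, lam t ω)) = Q.map (path (withLatent B A Γ)) := by
  obtain ⟨r, hr⟩ := exists_isTransition_logitKernel A Γ hB
  have hlam := hsol.lam_eq_latent hB hst
    (ae_latentSummable_jointPath hsol.measurable_X hsum)
  have hfst' : (P.map (jointPath X Y)).map Prod.fst = Q.map Prod.fst :=
    (map_fst_map_jointPath hsol.measurable_X hsol.measurable_Y).trans hfst.symm
  rw [map_path_eq_map_withLatent hsol.measurable_X hsol.measurable_Y hlam,
    IsCompatible.eq_of_map_fst_eq hr (hsol.isCompatible hB hlam) hQ hfst']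

theorem isStationaryErgodic_of_isCompatible [IsFiniteMeasure P]
    (hB : ∀ z : ℂ, charFun B z = 0 → 1 < ‖z‖) (hX : ∀ t, Measurable (X t))
    (hY : ∀ t, Measurable (Y t)) (hXerg : IsStationaryErgodic P X)
    (hcompat : IsCompatible (logitKernel B A Γ) (P.map (jointPath X Y))) :
    IsStationaryErgodic P fun t ω => (Y t ω, X t ω) := by
  obtain ⟨r, hr⟩ := exists_isTransition_logitKernel A Γ hB
  refine isStationaryErgodic_of_ergodic_skewShift hX hY <|
    hcompat.ergodic_skewShift hr (fun t y z => logitKernel_translate t 1 y z) ?_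
  rwa [map_fst_map_jointPath hX hY]

theorem exists_isCompatible_map_jointPath (hB : ∀ z : ℂ, charFun B z = 0 → 1 < ‖z‖)
    (A : Fin p → Matrix (Fin n) (Fin n) ℝ) (Γ : Matrix (Fin n) (Fin d) ℝ) (P : Measure Ω)
    [IsFiniteMeasure P] (hX : ∀ t, Measurable (X t)) :
    ∃ P' : Measure (Ω × (ℤ → Fin (n + 1))), P'.map Prod.fst = P ∧
      IsCompatible (logitKernel B A Γ)
        (P'.map (jointPath (fun t ω => X t ω.1) fun t ω => ω.2 t)) := by
  obtain ⟨r, hr⟩ := exists_isTransition_logitKernel A Γ hB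
  have hpath := measurable_path hX
  obtain ⟨P', hP', hcompat⟩ := exists_isCompatible (hr.comp_prodMap hpath) P
  refine ⟨P', hP', ?_⟩
  convert hcompat.map (g := logitKernel B A Γ) (c := 0) hpath (fun t y z => ?_)
    hr.measurable_prod using 3 with z
  · simp only [add_zero]
    rfl
  · simp only [add_zero]
    rfl

end Solution

end MultinomialLogit

end

open MultinomialLogit

theorem proposition4 {n d p q : ℕ} (hn : 1 ≤ n)
    (B : Fin q → Matrix (Fin n) (Fin n) ℝ) (A : Fin p → Matrix (Fin n) (Fin n) ℝ)
    (Γ : Matrix (Fin n) (Fin d) ℝ)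
    {Ω : Type*} [MeasurableSpace Ω] (P : Measure Ω) [IsProbabilityMeasure P]
    (X : ℤ → Ω → Fin d → ℝ) (hX : ∀ t, Measurable (X t))
    (hXerg : MultinomialLogit.IsStationaryErgodic P X)
    (hXlog : Integrable (fun ω => Real.posLog ‖X 1 ω‖) P)
    (hB : ∀ z : ℂ, MultinomialLogit.charFun B z = 0 → 1 < ‖z‖) :
    -- Existence, on the enlargement `Ω × {0, …, n}^ℤ` of the space on which `X` is defined.
    ∃ (P' : Measure (Ω × (ℤ → Fin (n + 1))))
      (X' : ℤ → Ω × (ℤ → Fin (n + 1)) → Fin d → ℝ)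
      (Y' : ℤ → Ω × (ℤ → Fin (n + 1)) → Fin (n + 1))
      (lam' : ℤ → Ω × (ℤ → Fin (n + 1)) → Fin n → ℝ),
      P'.map Prod.fst = P ∧ (∀ t ω, X' t ω = X t ω.1) ∧ (∀ t ω, Y' t ω = ω.2 t) ∧
      MultinomialLogit.IsSolution B A Γ P' X' Y' lam' ∧
      MultinomialLogit.IsStationary P' (fun t ω => (Y' t ω, X' t ω, lam' t ω)) ∧
      MultinomialLogit.IsStationaryErgodic P' (fun t ω => (Y' t ω, X' t ω)) ∧
      -- Uniqueness in law among the stationary solutions, on any probability space, driven by a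
      -- covariate process with the law of `X`.
      (∀ {Ω'' : Type*} [MeasurableSpace Ω''] (P'' : Measure Ω'') [IsProbabilityMeasure P'']
        (X'' : ℤ → Ω'' → Fin d → ℝ) (Y'' : ℤ → Ω'' → Fin (n + 1)) (lam'' : ℤ → Ω'' → Fin n → ℝ),
        P''.map (MultinomialLogit.path X'') = P.map (MultinomialLogit.path X) →
        MultinomialLogit.IsSolution B A Γ P'' X'' Y'' lam'' →
        MultinomialLogit.IsStationary P'' (fun t ω => (Y'' t ω, X'' t ω)) →
        P''.map (MultinomialLogit.path (fun t ω => (Y'' t ω, X'' t ω, lam'' t ω))) =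
          P'.map (MultinomialLogit.path (fun t ω => (Y' t ω, X' t ω, lam' t ω)))) := by
  obtain ⟨P', hfst, hcompat⟩ := exists_isCompatible_map_jointPath hB A Γ P hX
  have : IsProbabilityMeasure (P'.map Prod.fst) := by rwa [hfst]
  have : IsProbabilityMeasure P' := Measure.isProbabilityMeasure_of_map Prod.fst
  let X' (t : ℤ) (ω : Ω × (ℤ → Fin (n + 1))) : Fin d → ℝ := X t ω.1
  let Y' (t : ℤ) (ω : Ω × (ℤ → Fin (n + 1))) : Fin (n + 1) := ω.2 t
  have hX' (t : ℤ) : Measurable (X' t) := (hX t).comp measurable_fst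
  have hY' (t : ℤ) : Measurable (Y' t) := by fun_prop
  have hlaw : P'.map (path X') = P.map (path X) := by
    rw [← hfst, Measure.map_map (measurable_path hX) measurable_fst]
    rfl
  have hsum := ae_latentSummable_path (A := A) (Γ := Γ) hB hX hXerg.toMeasurePreserving hXlog
  have herg := isStationaryErgodic_of_isCompatible hB hX' hY'
    (by rwa [IsStationaryErgodic, hlaw]) hcompat
  refine ⟨P', X', Y', fun t => latent B A Γ t ∘ jointPath X' Y', hfst, fun _ _ => rfl,
    fun _ _ => rfl, isSolution_of_isCompatible hX' hY' (hlaw ▸ hsum) hcompat,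
    isStationary_of_ae_eq_latent hX' hY' (fun _ => .rfl) herg.toMeasurePreserving, herg, ?_⟩
  intro Ω'' _ P'' _ X'' Y'' lam'' hX'' hsol hst
  have hfst'' : (P'.map (jointPath X' Y')).map Prod.fst = P''.map (path X'') :=
    (map_fst_map_jointPath hX' hY').trans (hlaw.trans hX''.symm)
  rw [hsol.map_path_eq hB hst (hX'' ▸ hsum) hcompat hfst'',
    map_path_eq_map_withLatent hX' hY' fun _ => .rfl]
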